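/- Let $d\ge 2$, and let $\mathbb{B}^d=\{x\in\mathbb{R}^d:\|x\|<1\}$ be the Poincaré ball model of hyperbolic space, with $\cosh d_h(x,y)=1+\frac{2\|x-y\|^2}{(1-\|x\|^2)(1-\|y\|^2)}$. A unit vector $u$ and a point $x\in H:=u^\perp\cap\mathbb{B}^d$ determine the oriented hyperbolic line $L=L(H,x)$ through $x$ orthogonal to the totally geodesic hypersurface $H$, with $u$ as chosen unit normal $u_H$ of $H$; in the model it is $\mathbb{S}^1(L)\cap\mathbb{B}^d$ for a Euclidean circle $\mathbb{S}^1(L)$ orthogonal to $\mathbb{S}^{d-1}$ (a Euclidean line if $x=0$). Let $s_1(L)$ be the point of $\mathbb{S}^1(L)\cap\mathbb{S}^{d-1}$ with $\langle s_1(L),u_H\rangle>0$. The fat cylinder of $L=L(H,x)$ is the union of the lines in $\hat A_L=\{L(H,y): y\in H,\ d_h(x,y)<1\}$, and its endcap is $\{s_1(L'):L'\in\hat A_L\}\subset\mathbb{S}^{d-1}$. The space of these lines carries the measure $$\mu^h(\cdot)=\omega_d^{-1}\int_{\mathbb{S}^{d-1}}\int_{u^\perp\cap\mathbb{B}^d}\cosh(d_h(x,0))\,\mathbf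 1\{L(u^\perp\cap\mathbb{B}^d,x)\in\cdot\}\,\mathcal{H}^{d-1}(dx)\,\sigma_{d-1}(du),$$ where $\sigma_{d-1}$ is spherical Lebesgue measure, $\omega_d=\sigma_{d-1}(\mathbb{S}^{d-1})$, and $\mathcal{H}^{d-1}$ is hyperbolic $(d-1)$-dimensional volume. For $u\in\mathbb{S}^{d-1}$ and $\alpha\in(0,\pi]$ put $\operatorname{cap}(u,\alpha)=\{v\in\mathbb{S}^{d-1}:\arccos\langle u,v\rangle<\alpha\}$. Let $\gamma(t)=\arctan\frac{1-t^2}{2t}$ for $0<t<1$ and $\gamma(0)=\pi/2$; let $a(t)=\frac{\sqrt{\cosh^2(1)(1-t^2)^2+4t^2}-\cosh(1)(1-t^2)}{2t^2}$ and $\beta(t)=\arccos\frac{a(t)(1+t^2)}{1+a(t)^2t^2}$ for $0<t<1$, and $\beta(0)=\arccos(1/\cosh 1)$. For $L=L(H,x)$ with $x\ne0$ let $z(L)=\cos\gamma(a(\|x\|)\|x\|)\,\frac{x}{\|x\|}+\sin\gamma(a(\|x\|)\|x\|)\,u_H$, and let $z(L)=u_H$ if $x=0$. Let $F^-(L)=(z(L),\beta(\|x\|))\in\mathbb{S}^{d-1}\times(0,\pi]$,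 and let $\mu^{s,-}$ be the image of $\mu^h$ under $F^-$. Then: 1. for every line $L=L(H,x)$, the endcap of the fat cylinder of $L$ is the spherical cap $\operatorname{cap}(z(L),\beta(\|x\|))$; 2. for every $\lambda\ge0$, the image under $F^-$ of a Poisson process of lines with intensity measure $\lambda\mu^h$ is a Poisson process on $\mathbb{S}^{d-1}\times(0,\pi]$ with intensity measure $\lambda\mu^{s,-}$; 3. there is a constant $\lambda_1<\infty$, depending only on $d$, such that for every $\lambda>\lambda_1$ and every Poisson process $\Psi$ on $\mathbb{S}^{d-1}\times(0,\pi]$ with intensity measure $\lambda\mu^{s,-}$, $$\mathbb{P}\Big(\bigcup_{(u,\alpha)\in\Psi}\operatorname{cap}(u,\alpha)=\mathbb{S}^{d-1}\Big)=1.$$ -/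

import Mathlib

open MeasureTheory ProbabilityTheory Real
open scoped ENNReal NNReal

noncomputable section

/-- Euclidean `d`-space. -/
abbrev Euc (d : ℕ) : Type := EuclideanSpace ℝ (Fin d)

/-- The unit sphere of `ℝ^d`. -/
abbrev USphere (d : ℕ) : Type := Metric.sphere (0 : Euc d) 1

/-! ### Hyperbolic lines and fat cylinders in the Poincaré ball -/

/-- The hyperbolic distance of the Poincaré ball model (used for points of norm `< 1`). -/
def hypDist {d : ℕ} (x y : Euc d) : ℝ :=
  arcosh (1 + 2 * ‖x - y‖ ^ 2 / ((1 - ‖x‖ ^ 2) * (1 - ‖y‖ ^ 2)))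

/-- The space of (oriented) hyperbolic lines `L = L(H, x)`: a unit normal `u` of the totally
geodesic hypersurface `H = uᗮ ∩ 𝔹` through the centre of the ball `𝔹`, together with a point `x`
of `H`. The pair `(u, x)` stands for the line through `x` that is orthogonal to `H`, see
`HypLine.circle`. It carries the Borel σ-algebra inherited from `S^{d-1} × ℝ^d`. -/
abbrev HypLine (d : ℕ) : Type :=
  {p : USphere d × Euc d // ‖p.2‖ < 1 ∧ inner ℝ (p.1 : Euc d) p.2 = 0}

namespace HypLine

variable {d : ℕ}

/-- The chosen unit normal `u_H` of the orthogonal hypersurface `H`. -/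
def normal (L : HypLine d) : USphere d := L.1.1

/-- The point `x` in which the line meets `H`. -/
def foot (L : HypLine d) : Euc d := L.1.2

/-- The Euclidean circle in the plane `span {u, x}` which passes through `x`, is centred on the ray
from `0` through `x`, and is orthogonal to the unit sphere; it has centre
`((1 + ‖x‖²) / (2 ‖x‖²)) x` and radius `(1 - ‖x‖²) / (2 ‖x‖)`. For `x = 0` it is the Euclidean line
spanned by `u`. The hyperbolic line `L(H, x)` is the part of it in the open unit ball. -/
def circle (L : HypLine d) : Set (Euc d) :=
  {y | y ∈ Submodule.span ℝ {(L.normal : Euc d), L.foot} ∧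
    ‖L.foot‖ ^ 2 * (1 + ‖y‖ ^ 2) = (1 + ‖L.foot‖ ^ 2) * inner ℝ L.foot y}

/-- The hyperbolic line itself, as a subset of the open unit ball. -/
def carrier (L : HypLine d) : Set (Euc d) := L.circle ∩ Metric.ball 0 1

/-- The lines `L'` orthogonal to `H` with `d_h(L' ∩ H, x) < 1` (taken with the orientation
of `L`). -/
def parallelLines (L : HypLine d) : Set (HypLine d) :=
  {L' | L'.normal = L.normal ∧ hypDist L'.foot L.foot < 1}

/-- The open fat cylinder around `L`: the union of the lines in `L.parallelLines`. -/
def fatCylinder (L : HypLine d) : Set (Euc d) := ⋃ L' ∈ L.parallelLines, L'.carrier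

/-- The endcap of the fat cylinder around `L`: the set of those ideal endpoints `s₁(L')` of the
lines `L'` that make up the cylinder which lie on the side of `u_H`; the ideal endpoints of a line
are the two points in which its circle meets the unit sphere. -/
def endcapSet (L : HypLine d) : Set (USphere d) :=
  {v | 0 < inner ℝ (L.normal : Euc d) (v : Euc d) ∧
    ∃ L' ∈ L.parallelLines, (v : Euc d) ∈ L'.circle}

end HypLine

/-! ### Spherical caps and the endcap map -/

/-- The open spherical cap with centre `u` and spherical radius `α`; the spherical distance of `u`
and `v` is `arccos ⟨u, v⟩`. -/
def sphCap {d : ℕ} (u : USphere d) (α : ℝ) : Set (USphere d) :=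
  {v | arccos (inner ℝ (u : Euc d) (v : Euc d)) < α}

/-- Half the spherical length of the radial projection of a line at Euclidean distance `t` from
the centre. -/
def gammaFun (t : ℝ) : ℝ := if t = 0 then π / 2 else arctan ((1 - t ^ 2) / (2 * t))

/-- The function `a(t)`, used for `0 < t < 1`. -/
def aFun (t : ℝ) : ℝ :=
  (√(cosh 1 ^ 2 * (1 - t ^ 2) ^ 2 + 4 * t ^ 2) - cosh 1 * (1 - t ^ 2)) / (2 * t ^ 2)

/-- The spherical radius `β(t)` of the endcap of a cylinder around a line with `‖x‖ = t`. -/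
def betaFun (t : ℝ) : ℝ :=
  if t = 0 then arccos (1 / cosh 1)
  else arccos (aFun t * (1 + t ^ 2) / (1 + aFun t ^ 2 * t ^ 2))

theorem aFun_nonneg {t : ℝ} : 0 ≤ aFun t := by
  unfold aFun
  refine div_nonneg (sub_nonneg.2 (Real.le_sqrt_of_sq_le ?_)) (by positivity)
  nlinarith [sq_nonneg t]

theorem aFun_lt_one {t : ℝ} (h0 : 0 < t) (h1 : t < 1) : aFun t < 1 := by
  have hC : 1 < cosh 1 := Real.one_lt_cosh.2 one_ne_zero
  have ht : t ^ 2 < 1 := by nlinarith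
  have ht0 : 0 < t ^ 2 := by positivity
  unfold aFun
  rw [div_lt_one (by positivity), sub_lt_iff_lt_add, Real.sqrt_lt' (by nlinarith)]
  nlinarith [mul_pos (mul_pos ht0 (sub_pos.2 ht)) (sub_pos.2 hC)]

theorem betaFun_mem {t : ℝ} (h0 : 0 ≤ t) (h1 : t < 1) : betaFun t ∈ Set.Ioc 0 π := by
  have hC : 1 < cosh 1 := Real.one_lt_cosh.2 one_ne_zero
  unfold betaFun
  split_ifs with h
  · exact ⟨Real.arccos_pos.2 ((div_lt_one (by linarith)).2 hC), Real.arccos_le_pi _⟩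
  · have h0' : 0 < t := lt_of_le_of_ne h0 (Ne.symm h)
    have ha := aFun_lt_one h0' h1
    have ha0 := aFun_nonneg (t := t)
    refine ⟨Real.arccos_pos.2 ?_, Real.arccos_le_pi _⟩
    rw [div_lt_one (by positivity)]
    have ht : t ^ 2 < 1 := by nlinarith
    have : aFun t * t ^ 2 < 1 := by nlinarith [sq_nonneg t]
    nlinarith [mul_pos (sub_pos.2 ha) (sub_pos.2 this)]

namespace HypLine

variable {d : ℕ}

/-- The centre of the endcap as a vector:
`cos γ(a(‖x‖)‖x‖) x/‖x‖ + sin γ(a(‖x‖)‖x‖) u_H`; for `x = 0` this expression is `u_H`. -/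
def centerVec (L : HypLine d) : Euc d :=
  cos (gammaFun (aFun ‖L.foot‖ * ‖L.foot‖)) • (‖L.foot‖⁻¹ • L.foot) +
    sin (gammaFun (aFun ‖L.foot‖ * ‖L.foot‖)) • (L.normal : Euc d)

theorem norm_centerVec (L : HypLine d) : ‖L.centerVec‖ = 1 := by
  have hu : ‖(L.normal : Euc d)‖ = 1 := by simp
  have hxu : inner ℝ (L.normal : Euc d) L.foot = 0 := L.2.2
  unfold centerVec
  by_cases hx : L.foot = 0
  · simp [hx, gammaFun, hu]
  · have hn : ‖‖L.foot‖⁻¹ • L.foot‖ = 1 := by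
      rw [norm_smul, norm_inv, norm_norm, inv_mul_cancel₀ (norm_ne_zero_iff.2 hx)]
    generalize gammaFun (aFun ‖L.foot‖ * ‖L.foot‖) = θ
    have hi : inner ℝ (cos θ • (‖L.foot‖⁻¹ • L.foot)) (sin θ • (L.normal : Euc d)) = 0 := by
      rw [real_inner_comm] at hxu
      simp only [inner_smul_left, inner_smul_right, hxu, mul_zero]
    have := norm_add_sq_eq_norm_sq_add_norm_sq_of_inner_eq_zero _ _ hi
    rw [norm_smul, norm_smul (sin θ), hn, hu, mul_one, mul_one, Real.norm_eq_abs, Real.norm_eq_abs,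
      abs_mul_abs_self, abs_mul_abs_self] at this
    nlinarith [Real.sin_sq_add_cos_sq θ, norm_nonneg
      (cos θ • (‖L.foot‖⁻¹ • L.foot) + sin θ • (L.normal : Euc d))]

/-- The centre `z(L)` of the endcap. -/
def center (L : HypLine d) : USphere d := ⟨L.centerVec, by simp [L.norm_centerVec]⟩

/-- The endcap map `F⁻ : L(H, x) ↦ (z(L), β(‖x‖))`. -/
def endcap (L : HypLine d) : USphere d × Set.Ioc (0 : ℝ) π :=
  (L.center, ⟨betaFun ‖L.foot‖, betaFun_mem (norm_nonneg _) L.2.1⟩)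

theorem measurable_gammaFun : Measurable gammaFun := by
  unfold gammaFun
  exact Measurable.ite (measurableSet_singleton 0) measurable_const (by fun_prop)

theorem measurable_aFun : Measurable aFun := by
  unfold aFun
  fun_prop

theorem measurable_betaFun : Measurable betaFun := by
  unfold betaFun
  have := measurable_aFun
  exact Measurable.ite (measurableSet_singleton 0) measurable_const
    (Real.measurable_arccos.comp (by fun_prop))

theorem measurable_endcap : Measurable (endcap : HypLine d → _) := by
  have hf : Measurable (foot : HypLine d → Euc d) := measurable_snd.comp measurable_subtype_coe
  have hn : Measurable (fun L : HypLine d => (L.normal : Euc d)) :=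
    measurable_subtype_coe.comp (measurable_fst.comp measurable_subtype_coe)
  have hg := measurable_gammaFun
  have ha := measurable_aFun
  have hb := measurable_betaFun
  refine Measurable.prodMk (Measurable.subtype_mk ?_) (Measurable.subtype_mk ?_)
  · unfold centerVec
    fun_prop
  · fun_prop

end HypLine

/-! ### The invariant measure on lines -/

/-- The surface area `ω_d` of the unit sphere in `ℝ^d`. -/
def sphereArea (d : ℕ) : ℝ := 2 * π ^ ((d : ℝ) / 2) / Gamma ((d : ℝ) / 2)

/-- The spherical Lebesgue measure `σ_{d-1}`, of total mass `ω_d`. -/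
def sphMeasure (d : ℕ) : Measure (USphere d) := (volume : Measure (Euc d)).toSphere

/-- The hyperbolic `(d-1)`-dimensional volume on the hypersurface `H = uᗮ ∩ 𝔹`: it has density
`(2 / (1 - ‖x‖²))^(d-1)` with respect to Lebesgue measure on `uᗮ`. -/
def hyperplaneVolume {d : ℕ} (u : USphere d) : Measure (Euc d) :=
  (((volume : Measure (ℝ ∙ (u : Euc d))ᗮ).map Subtype.val).restrict (Metric.ball 0 1)).withDensity
    fun x => ENNReal.ofReal ((2 / (1 - ‖x‖ ^ 2)) ^ (d - 1))

/-- Lebesgue measure on `uᗮ` is the projection of Lebesgue measure on a slab of width one. -/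
theorem lintegral_orthogonal {d : ℕ} (u : USphere d) {g : Euc d → ℝ≥0∞} (hg : Measurable g) :
    ∫⁻ x, g x ∂((volume : Measure (ℝ ∙ (u : Euc d))ᗮ).map Subtype.val) =
      ∫⁻ y, (Set.Icc (0 : ℝ) 1).indicator 1 (inner ℝ (u : Euc d) y) *
        g (y - inner ℝ (u : Euc d) y • (u : Euc d)) := by
  have hu : ‖(u : Euc d)‖ = 1 := by simp
  set K : Submodule ℝ (Euc d) := ℝ ∙ (u : Euc d) with hK
  have hmp : MeasurePreserving (fun y : Euc d => (K.orthogonalDecomposition y).ofLp)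
      volume (volume : Measure (K × Kᗮ)) :=
    (WithLp.volume_preserving_ofLp K Kᗮ).comp K.orthogonalDecomposition.measurePreserving
  have hI : Measurable ((Set.Icc (0 : ℝ) 1).indicator (1 : ℝ → ℝ≥0∞)) :=
    measurable_one.indicator measurableSet_Icc
  have hproj : ∀ y : Euc d, (K.orthogonalProjectionOnto y : Euc d)
      = inner ℝ (u : Euc d) y • (u : Euc d) := by
    intro y
    exact Submodule.starProjection_unit_singleton ℝ hu y
  have hproj' : ∀ y : Euc d, (Kᗮ.orthogonalProjectionOnto y : Euc d)
      = y - inner ℝ (u : Euc d) y • (u : Euc d) := by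
    intro y
    rw [← hproj]
    exact Submodule.starProjection_orthogonal_val y
  have hF : Measurable (fun q : K × Kᗮ =>
      (Set.Icc (0 : ℝ) 1).indicator (1 : ℝ → ℝ≥0∞) (inner ℝ (u : Euc d) (q.1 : Euc d)) *
        g (q.2 : Euc d)) := by
    refine Measurable.mul (hI.comp (by fun_prop)) (hg.comp (by fun_prop))
  have h1 := hmp.lintegral_comp hF
  have h2 : ∫⁻ a : K, (Set.Icc (0 : ℝ) 1).indicator (1 : ℝ → ℝ≥0∞)
      (inner ℝ (u : Euc d) (a : Euc d)) = 1 := by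
    have hm := (LinearIsometryEquiv.toSpanUnitSingleton (𝕜 := ℝ) (u : Euc d) hu).measurePreserving
    have hIK : Measurable fun a : K => (Set.Icc (0 : ℝ) 1).indicator (1 : ℝ → ℝ≥0∞)
        (inner ℝ (u : Euc d) (a : Euc d)) := hI.comp (by fun_prop)
    rw [← hm.lintegral_comp hIK]
    have h4 : ∀ t : ℝ, (inner ℝ (u : Euc d)
        ((LinearIsometryEquiv.toSpanUnitSingleton (𝕜 := ℝ) (u : Euc d) hu t : K) : Euc d)) = t := by
      intro t
      simp [inner_smul_right]
    simp_rw [h4]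
    rw [lintegral_indicator_one measurableSet_Icc]
    simp
  rw [lintegral_map hg measurable_subtype_coe]
  have h3 : ∀ y : Euc d, (Set.Icc (0 : ℝ) 1).indicator (1 : ℝ → ℝ≥0∞) (inner ℝ (u : Euc d) y) *
        g (y - inner ℝ (u : Euc d) y • (u : Euc d)) =
      (Set.Icc (0 : ℝ) 1).indicator (1 : ℝ → ℝ≥0∞)
        (inner ℝ (u : Euc d) ((K.orthogonalDecomposition y).ofLp.1 : Euc d)) *
        g ((K.orthogonalDecomposition y).ofLp.2 : Euc d) := by
    intro y
    simp only [Submodule.orthogonalDecomposition_apply, hproj, hproj', inner_smul_right,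
      real_inner_self_eq_norm_sq, hu]
    simp
  simp_rw [h3]
  have h5 := lintegral_prod_mul (μ := (volume : Measure K)) (ν := (volume : Measure Kᗮ))
    (f := fun a => (Set.Icc (0 : ℝ) 1).indicator (1 : ℝ → ℝ≥0∞) (inner ℝ (u : Euc d) (a : Euc d)))
    (g := fun b => g (b : Euc d))
    (Measurable.aemeasurable (hI.comp (by fun_prop)))
    (Measurable.aemeasurable (hg.comp (by fun_prop)))
  rw [h1, Measure.volume_eq_prod, h5, h2, one_mul]

theorem measurable_lintegral_hyperplaneVolume {d : ℕ} {f : USphere d × Euc d → ℝ≥0∞}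
    (hf : Measurable f) : Measurable fun u => ∫⁻ x, f (u, x) ∂hyperplaneVolume u := by
  have hw : Measurable fun x : Euc d => ENNReal.ofReal ((2 / (1 - ‖x‖ ^ 2)) ^ (d - 1)) := by
    fun_prop
  set w : Euc d → ℝ≥0∞ := fun x => ENNReal.ofReal ((2 / (1 - ‖x‖ ^ 2)) ^ (d - 1)) with hwdef
  set G : USphere d × Euc d → ℝ≥0∞ := fun p =>
    (Metric.ball (0 : Euc d) 1).indicator (fun x => w x * f (p.1, x)) p.2 with hG
  have hGm : Measurable G := by
    have : G = (Set.univ ×ˢ Metric.ball (0 : Euc d) 1).indicator (fun p => w p.2 * f p) := by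
      ext p
      by_cases h : p.2 ∈ Metric.ball (0 : Euc d) 1 <;>
        simp [hG, h, Set.indicator_of_mem, Set.indicator_of_notMem]
    rw [this]
    exact Measurable.indicator (by fun_prop) (MeasurableSet.univ.prod measurableSet_ball)
  have key : ∀ u : USphere d, ∫⁻ x, f (u, x) ∂hyperplaneVolume u =
      ∫⁻ y, (Set.Icc (0 : ℝ) 1).indicator 1 (inner ℝ (u : Euc d) y) *
        G (u, y - inner ℝ (u : Euc d) y • (u : Euc d)) := by
    intro u
    rw [← lintegral_orthogonal u (g := fun x => G (u, x)) (by fun_prop), hyperplaneVolume,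
      lintegral_withDensity_eq_lintegral_mul _ hw (by fun_prop),
      ← lintegral_indicator measurableSet_ball]
    rfl
  simp_rw [key]
  have hI : Measurable ((Set.Icc (0 : ℝ) 1).indicator (1 : ℝ → ℝ≥0∞)) :=
    measurable_one.indicator measurableSet_Icc
  refine Measurable.lintegral_prod_right' (f := fun p : USphere d × Euc d =>
    (Set.Icc (0 : ℝ) 1).indicator 1 (inner ℝ (p.1 : Euc d) p.2) *
        G (p.1, p.2 - inner ℝ (p.1 : Euc d) p.2 • (p.1 : Euc d))) ?_
  exact Measurable.mul (hI.comp (by fun_prop)) (hGm.comp (by fun_prop))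

/-- The set of points of `S^{d-1} × ℝ^d` that parametrize a line in `A`. -/
def lineParams {d : ℕ} (A : Set (HypLine d)) : Set (USphere d × Euc d) := Subtype.val '' A

theorem measurableSet_lineParams {d : ℕ} {A : Set (HypLine d)} (hA : MeasurableSet A) :
    MeasurableSet (lineParams A) := by
  refine MeasurableSet.subtype_image (MeasurableSet.inter ?_ ?_) hA
  · exact measurableSet_lt (f := fun p : USphere d × Euc d => ‖p.2‖) (by fun_prop) measurable_const
  · exact measurableSet_eq_fun (f := fun p : USphere d × Euc d => inner ℝ (p.1 : Euc d) p.2)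
      (by fun_prop) measurable_const

theorem measurable_cosh_hypDist {d : ℕ} :
    Measurable fun p : USphere d × Euc d => ENNReal.ofReal (cosh (hypDist p.2 0)) := by
  unfold hypDist arcosh
  fun_prop

/-- The invariant measure `μ^h` on lines:
`μ^h(A) = ω_d⁻¹ ∫_{S^{d-1}} ∫_H cosh d_h(x, 0) 1{L(H, x) ∈ A} H^{d-1}(dx) σ_{d-1}(du)`. -/
def lineMeasure (d : ℕ) : Measure (HypLine d) :=
  Measure.ofMeasurable
    (fun A _ => (ENNReal.ofReal (sphereArea d))⁻¹ * ∫⁻ u, ∫⁻ x,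
      (lineParams A).indicator (fun p => ENNReal.ofReal (cosh (hypDist p.2 0))) (u, x)
        ∂hyperplaneVolume u ∂sphMeasure d)
    (by simp [lineParams])
    (by
      intro A hA hd
      have hm : ∀ i, Measurable ((lineParams (A i)).indicator
          fun p : USphere d × Euc d => ENNReal.ofReal (cosh (hypDist p.2 0))) := fun i =>
        measurable_cosh_hypDist.indicator (measurableSet_lineParams (hA i))
      have hdis : Pairwise fun i j => Disjoint (lineParams (A i)) (lineParams (A j)) :=
        fun i j hij => (Set.disjoint_image_iff Subtype.val_injective).2 (hd hij)
      have hsum : ∀ p, (lineParams (⋃ i, A i)).indicator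
          (fun p : USphere d × Euc d => ENNReal.ofReal (cosh (hypDist p.2 0))) p =
          ∑' i, (lineParams (A i)).indicator
            (fun p : USphere d × Euc d => ENNReal.ofReal (cosh (hypDist p.2 0))) p := by
        intro p
        have hU : lineParams (⋃ i, A i) = ⋃ i, lineParams (A i) := Set.image_iUnion
        rw [hU]
        by_cases hp : p ∈ ⋃ i, lineParams (A i)
        · obtain ⟨j, hj⟩ := Set.mem_iUnion.1 hp
          rw [Set.indicator_of_mem hp, tsum_eq_single j, Set.indicator_of_mem hj]
          intro i hij
          exact Set.indicator_of_notMem (fun h => (Set.disjoint_left.1 (hdis hij) h) hj) _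
        · rw [Set.indicator_of_notMem hp]
          symm
          refine ENNReal.tsum_eq_zero.2 fun i => Set.indicator_of_notMem (fun h => hp ?_) _
          exact Set.mem_iUnion.2 ⟨i, h⟩
      simp_rw [hsum]
      rw [ENNReal.tsum_mul_left, ← lintegral_tsum
        fun i => (measurable_lintegral_hyperplaneVolume (hm i)).aemeasurable]
      congr 2
      ext u
      exact lintegral_tsum fun i => ((hm i).comp measurable_prodMk_left).aemeasurable)

/-- The image measure `μ^{s,-}` of `μ^h` under the endcap map. -/
def endcapMeasure (d : ℕ) : Measure (USphere d × Set.Ioc (0 : ℝ) π) :=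
  (lineMeasure d).map HypLine.endcap

/-! ### Poisson processes -/

/-- A counting measure of a countable family of points (with multiplicities). -/
def IsPointMeasure {X : Type*} [MeasurableSpace X] (m : Measure X) : Prop :=
  ∃ (ι : Type) (_ : Countable ι) (x : ι → X), m = Measure.sum fun i => Measure.dirac (x i)

/-- `η` is a Poisson process on `X` with intensity measure `ν`, defined on the probability space
`(Ω, P)`: a random counting measure, such that the number of points in a measurable set `B` is
Poisson distributed with parameter `ν B` (almost surely infinite if `ν B = ∞`), and the numbers of
points in finitely many disjoint measurable sets are independent. -/
structure IsPoissonProcess {Ω X : Type*} [MeasurableSpace Ω] [MeasurableSpace X]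
    (η : Ω → Measure X) (ν : Measure X) (P : Measure Ω) : Prop where
  isPointMeasure : ∀ ω, IsPointMeasure (η ω)
  measurable : ∀ B, MeasurableSet B → Measurable fun ω => η ω B
  law : ∀ B, MeasurableSet B → ν B ≠ ∞ →
    P.map (fun ω => η ω B) = (poissonMeasure (ν B).toNNReal).map fun n : ℕ => (n : ℝ≥0∞)
  law_top : ∀ B, MeasurableSet B → ν B = ∞ → ∀ᵐ ω ∂P, η ω B = ∞
  indep : ∀ (n : ℕ) (B : Fin n → Set X), (∀ i, MeasurableSet (B i)) →
    Pairwise (fun i j => Disjoint (B i) (B j)) → iIndepFun (fun i ω => η ω (B i)) P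

/-- The region covered by the caps `cap(u, α)` with `(u, α)` a point of the configuration `m`. -/
def coveredRegion {d : ℕ} (m : Measure (USphere d × Set.Ioc (0 : ℝ) π)) : Set (USphere d) :=
  ⋃ p ∈ {p : USphere d × Set.Ioc (0 : ℝ) π | m {p} ≠ 0}, sphCap p.1 p.2

end

/-! Endcaps. The ideal endpoint of the line with normal `u` and foot `y` is `v = ((1 - ‖y‖²) u + 2
y) / (1 + ‖y‖²)`, the inverse stereographic image of `y` from the pole `-u` (`mem_circle_iff`). In
these terms `d_h(x, y) < 1` becomes, after division by `1 + ‖y‖²`, an inequality that is affine in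
`v`, namely `1 + ‖x‖² < ⟨2 x + cosh 1 (1 - ‖x‖²) u, v⟩`. A half-space cuts a cap out of the sphere,
and normalizing the vector gives its centre and radius (`endcapSet_eq_sphCap`). The statement on
images is the mapping theorem for Poisson processes.

Coverage. The intensity of caps around a point `v` diverges logarithmically. Put `h = ⟨u, v⟩ > 0`.
If the foot lies within `h / 5` of the foot of the line from `u` to `v`, then `1 - ‖x‖²` is
comparable to `h`, and the cap contains `v` with a margin of order `h²` in the cosine
(`endcap_mem_capsAround`). These feet have hyperbolic volume of order one and weight `cosh d_h(x,
0)` of order `1 / h`, whereas the normals with `h` of order `4^(-k)` have spherical measure of order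
`4^(-k)`. Every scale `k` therefore contributes at least a fixed constant, and the caps that contain
the whole `16^(-n) / 100`-neighbourhood of `v` have intensity at least `κ n`
(`le_endcapMeasure_capsAround`).

A net of mesh of order `16^(-n)` has at most exponentially many points in `n`, and each of its
neighbourhoods fails to lie in a single cap with probability at most `exp (-λ κ n)`. For large `λ`
the union bound tends to zero (`exists_intensity_covering`). -/

noncomputable section

/-! ### Endcaps as spherical caps -/

/-- The Euclidean norm of `HypLine.capAxis L` for a line with `‖L.foot‖ = t`. -/
def capAxisNorm (t : ℝ) : ℝ := √(cosh 1 ^ 2 * (1 - t ^ 2) ^ 2 + 4 * t ^ 2)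

theorem sq_capAxisNorm (t : ℝ) :
    capAxisNorm t ^ 2 = cosh 1 ^ 2 * (1 - t ^ 2) ^ 2 + 4 * t ^ 2 :=
  Real.sq_sqrt (by positivity)

/-- Since `(1 + t²)² = (1 - t²)² + 4 t²`, this is `cosh 1 ≥ 1`. It says that the hyperplane bounding
the endcap meets the sphere, so the cosine of the radius is at most one. -/
theorem one_add_sq_le_capAxisNorm (t : ℝ) : 1 + t ^ 2 ≤ capAxisNorm t := by
  have hC : 1 ≤ cosh 1 ^ 2 := one_le_pow₀ (Real.one_le_cosh 1)
  refine Real.le_sqrt_of_sq_le ?_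
  nlinarith [mul_nonneg (sub_nonneg.2 hC) (sq_nonneg (1 - t ^ 2))]

theorem capAxisNorm_pos (t : ℝ) : 0 < capAxisNorm t :=
  lt_of_lt_of_le (by positivity) (one_add_sq_le_capAxisNorm t)

theorem aFun_eq (t : ℝ) : aFun t = (capAxisNorm t - cosh 1 * (1 - t ^ 2)) / (2 * t ^ 2) := rfl

/-- `a(t)` is the smaller root of `t² a² - S a + 1 = 0` with `S = capAxisNorm t`. This relation
eliminates `a` from the formulas for `β` and `γ`. -/
theorem one_add_sq_aFun_mul {t : ℝ} (ht : t ≠ 0) :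
    1 + aFun t ^ 2 * t ^ 2 = aFun t * capAxisNorm t := by
  rw [aFun_eq]
  field_simp
  linear_combination -sq_capAxisNorm t

theorem betaFun_eq_arccos (t : ℝ) : betaFun t = arccos ((1 + t ^ 2) / capAxisNorm t) := by
  unfold betaFun
  split_ifs with h
  · simp [h, capAxisNorm, Real.sqrt_sq (Real.cosh_pos 1).le]
  · have h1 := one_add_sq_aFun_mul h
    have h2 := capAxisNorm_pos t
    have h3 : aFun t ≠ 0 := by
      intro h0
      simp [h0] at h1
    rw [h1, mul_div_mul_left _ _ h3]

/-- By the quadratic equation for `a(t)` the tangent of the angle is `cosh 1 (1 - t²) / (2 t)`, the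
slope of `capAxis` in the plane of foot and normal. -/
theorem cos_sin_gammaFun {t : ℝ} (h0 : 0 < t) :
    cos (gammaFun (aFun t * t)) = 2 * t / capAxisNorm t ∧
      sin (gammaFun (aFun t * t)) = cosh 1 * (1 - t ^ 2) / capAxisNorm t := by
  have h2 := capAxisNorm_pos t
  have ha1 := one_add_sq_aFun_mul h0.ne'
  have ha : 0 < aFun t := by
    refine lt_of_le_of_ne aFun_nonneg fun h => ?_
    simp [← h] at ha1
  have key : (1 - (aFun t * t) ^ 2) / (2 * (aFun t * t)) = cosh 1 * (1 - t ^ 2) / (2 * t) := by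
    rw [div_eq_div_iff (by positivity) (by positivity)]
    have h3 : aFun t * (2 * t ^ 2) = capAxisNorm t - cosh 1 * (1 - t ^ 2) := by
      rw [aFun_eq]
      field_simp
    linear_combination (2 * t) * ha1 + (-2 * t * aFun t) * h3
  have hsq : √(1 + (cosh 1 * (1 - t ^ 2) / (2 * t)) ^ 2) = capAxisNorm t / (2 * t) := by
    rw [Real.sqrt_eq_iff_eq_sq (by positivity) (by positivity), div_pow, div_pow, sq_capAxisNorm]
    field_simp
    ring
  unfold gammaFun
  rw [if_neg (by positivity), key, Real.cos_arctan, Real.sin_arctan, hsq]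
  constructor <;> field_simp

namespace HypLine

variable {d : ℕ}

/-- A vector normal to the hyperplane that cuts the endcap out of the unit sphere. -/
def capAxis (L : HypLine d) : Euc d :=
  (2 : ℝ) • L.foot + (cosh 1 * (1 - ‖L.foot‖ ^ 2)) • (L.normal : Euc d)

theorem inner_normal_foot (L : HypLine d) : inner ℝ (L.normal : Euc d) L.foot = 0 := L.2.2

theorem norm_foot_lt_one (L : HypLine d) : ‖L.foot‖ < 1 := L.2.1

theorem centerVec_eq (L : HypLine d) :
    L.centerVec = (capAxisNorm ‖L.foot‖)⁻¹ • L.capAxis := by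
  unfold centerVec capAxis
  by_cases hx : L.foot = 0
  · have hC := (Real.cosh_pos 1)
    simp [hx, gammaFun, capAxisNorm, Real.sqrt_sq hC.le, smul_smul, hC.ne']
  · have h0 : 0 < ‖L.foot‖ := norm_pos_iff.2 hx
    obtain ⟨hc, hs⟩ := cos_sin_gammaFun h0
    rw [hc, hs, smul_add, smul_smul, smul_smul, smul_smul]
    congr 2
    · field_simp
    · field_simp

theorem mem_sphCap_endcap_iff (L : HypLine d) (v : USphere d) :
    v ∈ sphCap L.endcap.1 L.endcap.2 ↔
      1 + ‖L.foot‖ ^ 2 < inner ℝ L.capAxis (v : Euc d) := by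
  have hS := capAxisNorm_pos ‖L.foot‖
  have hv : ‖(v : Euc d)‖ = 1 := by simp
  have h1 : |inner ℝ (L.center : Euc d) (v : Euc d)| ≤ 1 := by
    have := abs_real_inner_le_norm (L.center : Euc d) (v : Euc d)
    simpa [hv, L.norm_centerVec] using this
  have h2 : (1 + ‖L.foot‖ ^ 2) / capAxisNorm ‖L.foot‖ ∈ Set.Icc (-1 : ℝ) 1 :=
    ⟨by linarith [show 0 ≤ (1 + ‖L.foot‖ ^ 2) / capAxisNorm ‖L.foot‖ by positivity],
      (div_le_one hS).2 (one_add_sq_le_capAxisNorm _)⟩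
  change arccos (inner ℝ (L.center : Euc d) (v : Euc d)) < betaFun ‖L.foot‖ ↔ _
  rw [betaFun_eq_arccos, strictAntiOn_arccos.lt_iff_gt ⟨(abs_le.1 h1).1, (abs_le.1 h1).2⟩ h2]
  change _ < inner ℝ L.centerVec (v : Euc d) ↔ _
  rw [centerVec_eq, inner_smul_left, conj_trivial, div_lt_iff₀ hS, mul_comm, ← mul_assoc,
    mul_inv_cancel₀ hS.ne', one_mul]

theorem cos_endcap_snd (L : HypLine d) :
    cos (L.endcap.2 : ℝ) = (1 + ‖L.foot‖ ^ 2) / capAxisNorm ‖L.foot‖ := by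
  have hS := capAxisNorm_pos ‖L.foot‖
  change cos (betaFun ‖L.foot‖) = _
  rw [betaFun_eq_arccos, cos_arccos]
  · linarith [show 0 ≤ (1 + ‖L.foot‖ ^ 2) / capAxisNorm ‖L.foot‖ by positivity]
  · exact (div_le_one hS).2 (one_add_sq_le_capAxisNorm _)

/-- The ideal endpoint of a line on the side of `u_H`, in terms of its foot. -/
theorem mem_circle_iff (L : HypLine d) {v : USphere d}
    (hv : 0 < inner ℝ (L.normal : Euc d) (v : Euc d)) :
    (v : Euc d) ∈ L.circle ↔ (1 + ‖L.foot‖ ^ 2) • (v : Euc d) =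
      (1 - ‖L.foot‖ ^ 2) • (L.normal : Euc d) + (2 : ℝ) • L.foot := by
  have hu : ‖(L.normal : Euc d)‖ = 1 := by simp
  have hv1 : ‖(v : Euc d)‖ = 1 := by simp
  have hux := L.inner_normal_foot
  have hr := L.norm_foot_lt_one
  have hr0 := norm_nonneg L.foot
  have hxu : inner ℝ L.foot (L.normal : Euc d) = 0 := by rw [real_inner_comm, hux]
  unfold circle
  set u : Euc d := (L.normal : Euc d)
  set w : Euc d := (v : Euc d)
  set x : Euc d := L.foot
  constructor
  · rintro ⟨hmem, heq⟩
    obtain ⟨a, b, hab⟩ := Submodule.mem_span_pair.1 hmem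
    rw [hv1] at heq
    have ha : inner ℝ u w = a := by
      rw [← hab, inner_add_right, inner_smul_right, inner_smul_right, hux,
        real_inner_self_eq_norm_sq, hu]
      ring
    have hb : inner ℝ x w = b * ‖x‖ ^ 2 := by
      rw [← hab, inner_add_right, inner_smul_right, inner_smul_right, hxu,
        real_inner_self_eq_norm_sq]
      ring
    have hn : a ^ 2 + b ^ 2 * ‖x‖ ^ 2 = 1 := by
      have : inner ℝ w w = 1 := by rw [real_inner_self_eq_norm_sq, hv1]; norm_num
      nth_rewrite 1 [← hab] at this
      rw [inner_add_left, inner_smul_left, inner_smul_left, ha, hb] at this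
      simp only [conj_trivial] at this
      linarith
    rw [ha] at hv
    rw [hb] at heq
    -- For `x = 0` the circle equation is vacuous; membership in the span, unit norm and the sign of
    -- `a` then determine the endpoint.
    by_cases hx : x = 0
    · have : a = 1 := by
        simp only [hx, norm_zero] at hn
        nlinarith
      rw [← hab, this, hx]
      simp
    · have hx0 : 0 < ‖x‖ ^ 2 := by positivity
      have hb2 : (1 + ‖x‖ ^ 2) * b = 2 := by
        apply mul_right_cancel₀ hx0.ne'
        linarith
      have ha2 : (1 + ‖x‖ ^ 2) * a = 1 - ‖x‖ ^ 2 := by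
        -- The unit norm gives `a` only up to sign; positivity of `⟨u, v⟩` selects the endpoint.
        have h1 : ((1 + ‖x‖ ^ 2) * a) ^ 2 = (1 - ‖x‖ ^ 2) ^ 2 := by
          linear_combination (1 + ‖x‖ ^ 2) ^ 2 * hn -
            ‖x‖ ^ 2 * ((1 + ‖x‖ ^ 2) * b + 2) * hb2
        exact (sq_eq_sq₀ (by positivity) (by nlinarith)).1 h1
      rw [← hab, smul_add, smul_smul, smul_smul, ha2, hb2]
  · intro h
    have hpos : (0 : ℝ) < 1 + ‖x‖ ^ 2 := by positivity
    constructor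
    · have : w = ((1 + ‖x‖ ^ 2)⁻¹ * (1 - ‖x‖ ^ 2)) • u + ((1 + ‖x‖ ^ 2)⁻¹ * 2) • x := by
        rw [mul_smul, mul_smul, ← smul_add, ← h, smul_smul, inv_mul_cancel₀ hpos.ne', one_smul]
      rw [this]
      exact Submodule.mem_span_pair.2 ⟨_, _, rfl⟩
    · change ‖x‖ ^ 2 * (1 + ‖w‖ ^ 2) = (1 + ‖x‖ ^ 2) * inner ℝ x w
      rw [← inner_smul_right, h, inner_add_right, inner_smul_right, inner_smul_right, hxu,
        real_inner_self_eq_norm_sq, hv1]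
      ring

/-- Apply `cosh` and clear denominators: `2 ‖x - y‖² + (1 - ‖x‖²)(1 - ‖y‖²) = (1 + ‖x‖²)(1 + ‖y‖²) -
4 ⟨x, y⟩`. -/
theorem hypDist_lt_one_iff {x y : Euc d} (hx : ‖x‖ < 1) (hy : ‖y‖ < 1) :
    hypDist x y < 1 ↔ (1 + ‖x‖ ^ 2) * (1 + ‖y‖ ^ 2) - 4 * inner ℝ x y <
      cosh 1 * ((1 - ‖x‖ ^ 2) * (1 - ‖y‖ ^ 2)) := by
  have hx2 : 0 < 1 - ‖x‖ ^ 2 := by nlinarith [norm_nonneg x]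
  have hy2 : 0 < 1 - ‖y‖ ^ 2 := by nlinarith [norm_nonneg y]
  have hp := mul_pos hx2 hy2
  unfold hypDist
  conv_lhs => rhs; rw [← Real.arcosh_cosh zero_le_one]
  rw [arcosh_lt_arcosh (by positivity) (Real.cosh_pos _), ← lt_sub_iff_add_lt', div_lt_iff₀ hp,
    norm_sub_sq_real]
  constructor <;> intro h <;> linarith

/-- The endcap of a fat cylinder is a spherical cap. -/
theorem endcapSet_eq_sphCap (L : HypLine d) :
    L.endcapSet = sphCap L.endcap.1 L.endcap.2 := by
  ext v
  rw [mem_sphCap_endcap_iff]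
  have hu : ‖(L.normal : Euc d)‖ = 1 := by simp
  have hv1 : ‖(v : Euc d)‖ = 1 := by simp
  have hux := L.inner_normal_foot
  have hr := L.norm_foot_lt_one
  have hr0 := norm_nonneg L.foot
  have hxu : inner ℝ L.foot (L.normal : Euc d) = 0 := by rw [real_inner_comm, hux]
  have key : ∀ y : Euc d, ‖y‖ < 1 → (1 + ‖y‖ ^ 2) • (v : Euc d) =
      (1 - ‖y‖ ^ 2) • (L.normal : Euc d) + (2 : ℝ) • y → inner ℝ (L.normal : Euc d) y = 0 →
      (hypDist y L.foot < 1 ↔ 1 + ‖L.foot‖ ^ 2 < inner ℝ L.capAxis (v : Euc d)) := by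
    intro y hy h huy
    have hpos : (0 : ℝ) < 1 + ‖y‖ ^ 2 := by positivity
    have h1 : (1 + ‖y‖ ^ 2) * inner ℝ L.capAxis (v : Euc d) =
        4 * inner ℝ y L.foot + cosh 1 * ((1 - ‖y‖ ^ 2) * (1 - ‖L.foot‖ ^ 2)) := by
      rw [← inner_smul_right, h, capAxis]
      simp only [inner_add_left, inner_add_right, inner_smul_left, inner_smul_right,
        conj_trivial, hxu, huy, real_inner_self_eq_norm_sq, hu, real_inner_comm L.foot y]
      ring
    rw [hypDist_lt_one_iff hy hr, ← mul_lt_mul_iff_right₀ hpos (b := 1 + _), h1, sub_lt_iff_lt_add']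
  constructor
  · rintro ⟨h0, L', ⟨hn, hL'⟩, hc⟩
    rw [← hn] at h0
    have h := (L'.mem_circle_iff h0).1 hc
    have huy := L'.inner_normal_foot
    rw [hn] at h huy
    exact (key _ L'.norm_foot_lt_one h huy).1 hL'
  · intro hm
    -- The cap lies on the side of `u`: the foot contributes at most `2 ‖x‖ ≤ 1 + ‖x‖²` to the inner
    -- product, so the normal must contribute something positive.
    have h0 : 0 < inner ℝ (L.normal : Euc d) (v : Euc d) := by
      rw [capAxis, inner_add_left, inner_smul_left, inner_smul_left, conj_trivial,
        conj_trivial] at hm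
      have h1 := real_inner_le_norm L.foot (v : Euc d)
      rw [hv1, mul_one] at h1
      have h2 : 0 < cosh 1 * (1 - ‖L.foot‖ ^ 2) := mul_pos (Real.cosh_pos 1) (by nlinarith)
      refine pos_of_mul_pos_right (a := cosh 1 * (1 - ‖L.foot‖ ^ 2)) ?_ h2.le
      nlinarith [sq_nonneg (1 - ‖L.foot‖)]
    set h : ℝ := inner ℝ (L.normal : Euc d) (v : Euc d) with hh
    -- The stereographic projection of `v` from `-u`; it is the foot of the line that ends in `v`.
    set y : Euc d := (1 + h)⁻¹ • ((v : Euc d) - h • (L.normal : Euc d)) with hy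
    have huy : inner ℝ (L.normal : Euc d) y = 0 := by
      rw [hy, inner_smul_right, inner_sub_right, inner_smul_right, real_inner_self_eq_norm_sq, hu,
        ← hh]
      ring
    have hpos : 0 < 1 + h := by linarith
    have hn2 : ‖(v : Euc d) - h • (L.normal : Euc d)‖ ^ 2 = 1 - h ^ 2 := by
      rw [norm_sub_sq_real, inner_smul_right, real_inner_comm, ← hh, norm_smul, hv1, hu,
        Real.norm_eq_abs, mul_one, sq_abs]
      ring
    have hny : ‖y‖ ^ 2 = (1 - h) / (1 + h) := by
      rw [hy, norm_smul, mul_pow, hn2, Real.norm_eq_abs, sq_abs]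
      field_simp
      ring
    have hy1 : ‖y‖ < 1 := by
      refine lt_of_pow_lt_pow_left₀ 2 zero_le_one ?_
      rw [hny, one_pow, div_lt_one hpos]
      linarith
    have hv : (1 + ‖y‖ ^ 2) • (v : Euc d) =
        (1 - ‖y‖ ^ 2) • (L.normal : Euc d) + (2 : ℝ) • y := by
      have e1 : 1 + ‖y‖ ^ 2 = 2 * (1 + h)⁻¹ := by rw [hny]; field_simp; ring
      have e2 : 1 - ‖y‖ ^ 2 = 2 * (1 + h)⁻¹ * h := by rw [hny]; field_simp; ring
      rw [e1, e2, hy, smul_smul, mul_smul _ h, ← smul_add]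
      congr 1
      abel
    refine ⟨h0, ⟨(L.normal, y), hy1, huy⟩, ⟨rfl, (key y hy1 hv huy).2 hm⟩, ?_⟩
    exact (mem_circle_iff ⟨(L.normal, y), hy1, huy⟩ h0).2 hv

end HypLine

/-! ### Images and void probabilities of Poisson processes -/

section Poisson

variable {Ω X Y : Type*} [MeasurableSpace Ω] [MeasurableSpace X] [MeasurableSpace Y]

theorem IsPointMeasure.map {m : Measure X} (hm : IsPointMeasure m) {f : X → Y}
    (hf : Measurable f) : IsPointMeasure (m.map f) := by
  obtain ⟨ι, hι, x, rfl⟩ := hm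
  refine ⟨ι, hι, fun i => f (x i), ?_⟩
  rw [Measure.map_sum hf.aemeasurable]
  simp_rw [Measure.map_dirac' hf]

/-- Turns a positive count into an actual point of the configuration, as the definition of the
covered region requires. Singletons need not be measurable here. -/
theorem IsPointMeasure.exists_mem_singleton_ne_zero {m : Measure X} (hm : IsPointMeasure m)
    {B : Set X} (hB : MeasurableSet B) (h : m B ≠ 0) : ∃ p ∈ B, m {p} ≠ 0 := by
  obtain ⟨ι, hι, x, rfl⟩ := hm
  rw [Measure.sum_apply _ hB] at h
  obtain ⟨i, hi⟩ : ∃ i, Measure.dirac (x i) B ≠ 0 := by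
    by_contra! h0
    exact h (ENNReal.tsum_eq_zero.2 h0)
  rw [Measure.dirac_apply' _ hB] at hi
  refine ⟨x i, by_contra fun hx => hi (Set.indicator_of_notMem hx _), fun h0 => ?_⟩
  have h1 : (1 : ℝ≥0∞) ≤ Measure.dirac (x i) {x i} := by
    simpa only [Set.indicator_of_mem (Set.mem_singleton (x i)), Pi.one_apply] using
      Measure.le_dirac_apply (a := x i) (s := {x i})
  have h2 := Measure.le_sum (fun i => Measure.dirac (x i)) i {x i}
  rw [h0] at h2
  exact absurd (h1.trans h2) (by simp)

theorem IsPoissonProcess.map {η : Ω → Measure X} {ν : Measure X} {P : Measure Ω}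
    (h : IsPoissonProcess η ν P) {f : X → Y} (hf : Measurable f) :
    IsPoissonProcess (fun ω => (η ω).map f) (ν.map f) P where
  isPointMeasure ω := (h.isPointMeasure ω).map hf
  measurable B hB := by
    simp_rw [Measure.map_apply hf hB]
    exact h.measurable _ (hf hB)
  law B hB hν := by
    simp_rw [Measure.map_apply hf hB] at hν ⊢
    exact h.law _ (hf hB) hν
  law_top B hB hν := by
    simp_rw [Measure.map_apply hf hB] at hν ⊢
    exact h.law_top _ (hf hB) hν
  indep n B hB hd := by
    have := h.indep n (fun i => f ⁻¹' B i) (fun i => hf (hB i))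
      (fun i j hij => (hd hij).preimage f)
    simpa only [Measure.map_apply hf (hB _)] using this

/-- The void probability is `exp (-ν B)`. Stating it through a real lower bound `c` treats infinite
`ν B` along with the finite case. -/
theorem IsPoissonProcess.measure_eq_zero_le {η : Ω → Measure X} {ν : Measure X} {P : Measure Ω}
    (h : IsPoissonProcess η ν P) {B : Set X} (hB : MeasurableSet B) {c : ℝ}
    (hc : ENNReal.ofReal c ≤ ν B) : P {ω | η ω B = 0} ≤ ENNReal.ofReal (exp (-c)) := by
  by_cases hν : ν B = ∞
  · have h0 := h.law_top B hB hν
    have : P {ω | η ω B = 0} = 0 := by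
      refine measure_mono_null (fun ω (hω : η ω B = 0) => ?_) h0
      simp [hω]
    simp [this]
  · have h1 : P {ω | η ω B = 0} = P.map (fun ω => η ω B) {0} := by
      rw [Measure.map_apply (h.measurable B hB) (measurableSet_singleton 0)]
      rfl
    have h2 : (fun n : ℕ => (n : ℝ≥0∞)) ⁻¹' {0} = {0} := by
      ext n
      simp
    rw [h1, h.law B hB hν, Measure.map_apply .of_discrete (measurableSet_singleton 0), h2,
      poissonMeasure_singleton]
    refine ENNReal.ofReal_le_ofReal ?_
    simpa [ENNReal.coe_toNNReal_eq_toReal] using (ENNReal.ofReal_le_iff_le_toReal hν).1 hc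

end Poisson

/-! ### Nets of the sphere -/

/-- A single finite `ε`-net of the unit ball is iterated: translated and rescaled by `ε ^ n`, it
refines each ball of radius `ε ^ n`, so the cardinality grows only by the factor `N` per step. -/
theorem exists_finset_closedBall_cover (E : Type*) [NormedAddCommGroup E] [NormedSpace ℝ E]
    [FiniteDimensional ℝ E] {ε : ℝ} (hε : 0 < ε) :
    ∃ N : ℕ, ∀ n : ℕ, ∃ s : Finset E, s.card ≤ N ^ n ∧
      ∀ x ∈ Metric.closedBall (0 : E) 1, ∃ c ∈ s, dist x c ≤ ε ^ n := by
  classical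
  have : ProperSpace E := FiniteDimensional.proper ℝ E
  obtain ⟨t, -, ht, htc⟩ := (isCompact_closedBall (0 : E) 1).finite_cover_balls hε
  refine ⟨ht.toFinset.card, fun n => ?_⟩
  induction n with
  | zero => exact ⟨{0}, by simp, fun x hx => ⟨0, by simp, by simpa using hx⟩⟩
  | succ n ih =>
    obtain ⟨s, hs, hsc⟩ := ih
    refine ⟨Finset.image₂ (fun c y => c + ε ^ n • y) s ht.toFinset, ?_, fun x hx => ?_⟩
    · rw [pow_succ]
      exact (Finset.card_image₂_le _ _ _).trans (Nat.mul_le_mul_right _ hs)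
    · obtain ⟨c, hc, hxc⟩ := hsc x hx
      have hn : 0 < ε ^ n := by positivity
      have hy : (ε ^ n)⁻¹ • (x - c) ∈ Metric.closedBall (0 : E) 1 := by
        rw [mem_closedBall_zero_iff, norm_smul, norm_inv, Real.norm_of_nonneg hn.le,
          inv_mul_le_iff₀ hn, mul_one, ← dist_eq_norm]
        exact hxc
      obtain ⟨y, hyt, hy⟩ := Set.mem_iUnion₂.1 (htc hy)
      refine ⟨_, Finset.mem_image₂_of_mem hc (ht.mem_toFinset.2 hyt), ?_⟩
      rw [Metric.mem_ball, dist_eq_norm] at hy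
      have e : x - (c + ε ^ n • y) = ε ^ n • ((ε ^ n)⁻¹ • (x - c) - y) := by
        rw [smul_sub, smul_smul, mul_inv_cancel₀ hn.ne', one_smul]
        abel
      rw [dist_eq_norm, e, norm_smul, Real.norm_of_nonneg hn.le, pow_succ]
      exact mul_le_mul_of_nonneg_left hy.le hn.le

theorem exists_finset_sphere_net (d : ℕ) {ε : ℝ} (hε : 0 < ε) :
    ∃ N : ℕ, ∀ n : ℕ, ∃ s : Finset (USphere d), s.card ≤ N ^ n ∧
      ∀ v : USphere d, ∃ c ∈ s, dist v c ≤ 2 * ε ^ n := by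
  classical
  obtain ⟨N, hN⟩ := exists_finset_closedBall_cover (Euc d) hε
  refine ⟨N, fun n => ?_⟩
  obtain ⟨s, hs, hsc⟩ := hN n
  rcases isEmpty_or_nonempty (USphere d) with he | ⟨⟨v₀⟩⟩
  · exact ⟨∅, by simp, fun v => he.elim v⟩
  -- Net points near the sphere are moved onto it, which doubles the mesh; `v₀` is a junk value for
  -- the others.
  let g : Euc d → USphere d := fun c =>
    if h : ∃ w : USphere d, dist (w : Euc d) c ≤ ε ^ n then h.choose else v₀
  refine ⟨s.image g, Finset.card_image_le.trans hs, fun v => ?_⟩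
  obtain ⟨c, hc, hvc⟩ := hsc v (by simp)
  refine ⟨g c, Finset.mem_image_of_mem g hc, ?_⟩
  have h : ∃ w : USphere d, dist (w : Euc d) c ≤ ε ^ n := ⟨v, hvc⟩
  have hg : dist (g c : Euc d) c ≤ ε ^ n := by
    simp only [g, dif_pos h]
    exact h.choose_spec
  rw [Subtype.dist_eq]
  linarith [dist_triangle_right (v : Euc d) (g c) c]

/-! ### Coverage by a Poisson process of caps -/

/-- Caps that contain, with room to spare, the points of the sphere at distance at most `δ`
from `v`. -/
def capsAround {d : ℕ} (v : USphere d) (δ : ℝ) : Set (USphere d × Set.Ioc (0 : ℝ) π) :=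
  {p | cos (p.2 : ℝ) + δ < inner ℝ (p.1 : Euc d) (v : Euc d)}

theorem measurableSet_capsAround {d : ℕ} (v : USphere d) (δ : ℝ) :
    MeasurableSet (capsAround v δ) := by
  refine measurableSet_lt ?_ ?_
  · fun_prop
  · fun_prop

theorem mem_sphCap_of_mem_capsAround {d : ℕ} {v w : USphere d} {δ : ℝ}
    {p : USphere d × Set.Ioc (0 : ℝ) π} (hp : p ∈ capsAround v δ) (hw : dist w v ≤ δ) :
    w ∈ sphCap p.1 p.2 := by
  have hp1 : ‖(p.1 : Euc d)‖ = 1 := by simp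
  have h1 : inner ℝ (p.1 : Euc d) ((v : Euc d) - w) ≤ δ := by
    refine (real_inner_le_norm _ _).trans ?_
    rwa [hp1, one_mul, ← dist_eq_norm, dist_comm, ← Subtype.dist_eq]
  have h2 : cos (p.2 : ℝ) < inner ℝ (p.1 : Euc d) (w : Euc d) := by
    rw [inner_sub_right] at h1
    have : cos (p.2 : ℝ) + δ < inner ℝ (p.1 : Euc d) (v : Euc d) := hp
    linarith
  have h3 : inner ℝ (p.1 : Euc d) (w : Euc d) ≤ 1 := by
    simpa using real_inner_le_norm (p.1 : Euc d) (w : Euc d)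
  have h4 := Real.arccos_lt_arccos (neg_one_le_cos _) h2 h3
  rwa [Real.arccos_cos p.2.2.1.le p.2.2.2] at h4

/-- A union bound over nets: intensity growing linearly in `n` beats the exponential growth of the
nets once `λ κ > log (N + 1)`. The offset `k` makes the mesh `2 ε ^ (k + n)` at most `A ε ^ n`. -/
theorem exists_intensity_covering {d : ℕ} {μ : Measure (USphere d × Set.Ioc (0 : ℝ) π)} {κ ε A : ℝ}
    (hκ : 0 < κ) (hε : 0 < ε) (k : ℕ) (hA : 2 * ε ^ k ≤ A)
    (hμ : ∀ (n : ℕ) (v : USphere d), ENNReal.ofReal (κ * n) ≤ μ (capsAround v (A * ε ^ n))) :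
    ∃ lam₁ : ℝ≥0, ∀ lam : ℝ≥0, lam₁ < lam →
      ∀ (Ω : Type*) [MeasurableSpace Ω] (P : Measure Ω)
        (Φ : Ω → Measure (USphere d × Set.Ioc (0 : ℝ) π)),
        IsPoissonProcess Φ (lam • μ) P → ∀ᵐ ω ∂P, coveredRegion (Φ ω) = Set.univ := by
  obtain ⟨N, hN⟩ := exists_finset_sphere_net d hε
  refine ⟨(log (N + 1) / κ).toNNReal, fun lam hlam Ω _ P Φ hΦ => ?_⟩
  have hq : ((N : ℝ) + 1) * exp (-(lam * κ)) < 1 := by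
    have h1 : log (N + 1) / κ < lam := (Real.toNNReal_lt_iff_lt_coe (by
      exact div_nonneg (Real.log_nonneg (by simp)) hκ.le)).1 hlam
    rw [div_lt_iff₀ hκ, Real.log_lt_iff_lt_exp (by positivity)] at h1
    rwa [Real.exp_neg, ← div_eq_mul_inv, div_lt_one (Real.exp_pos _)]
  -- Only monotonicity and subadditivity of `P` are used, so measurability of the non-covering event
  -- is not needed.
  have hbound : ∀ n : ℕ, P {ω | ¬ coveredRegion (Φ ω) = Set.univ} ≤
      ENNReal.ofReal (((N : ℝ) + 1) ^ k * (((N : ℝ) + 1) * exp (-(lam * κ))) ^ n) := by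
    intro n
    obtain ⟨s, hs, hsc⟩ := hN (k + n)
    have hsub : {ω | ¬ coveredRegion (Φ ω) = Set.univ} ⊆
        ⋃ c ∈ s, {ω | Φ ω (capsAround c (A * ε ^ n)) = 0} := by
      intro ω hω
      by_contra hcon
      simp only [Set.mem_iUnion, not_exists] at hcon
      refine hω (Set.eq_univ_of_forall fun v => ?_)
      obtain ⟨c, hc, hvc⟩ := hsc v
      obtain ⟨p, hp, hpm⟩ := (hΦ.isPointMeasure ω).exists_mem_singleton_ne_zero
        (measurableSet_capsAround c (A * ε ^ n)) (hcon c hc)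
      refine Set.mem_biUnion (x := p) hpm (mem_sphCap_of_mem_capsAround hp (hvc.trans ?_))
      rw [pow_add, ← mul_assoc]
      exact mul_le_mul_of_nonneg_right hA (by positivity)
    have hone : ∀ c : USphere d, P {ω | Φ ω (capsAround c (A * ε ^ n)) = 0} ≤
        ENNReal.ofReal (exp (-(lam * κ * n))) := fun c =>
      hΦ.measure_eq_zero_le (measurableSet_capsAround c _) (by
        rw [mul_assoc, ENNReal.ofReal_mul (NNReal.coe_nonneg lam), ENNReal.ofReal_coe_nnreal,
          Measure.smul_apply, ENNReal.smul_def, smul_eq_mul]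
        exact mul_le_mul_right (hμ n c) _)
    calc P {ω | ¬ coveredRegion (Φ ω) = Set.univ}
        ≤ P (⋃ c ∈ s, {ω | Φ ω (capsAround c (A * ε ^ n)) = 0}) := measure_mono hsub
      _ ≤ ∑ c ∈ s, P {ω | Φ ω (capsAround c (A * ε ^ n)) = 0} := measure_biUnion_finset_le _ _
      _ ≤ ∑ c ∈ s, ENNReal.ofReal (exp (-(lam * κ * n))) := Finset.sum_le_sum fun c _ => hone c
      _ = ENNReal.ofReal (s.card * exp (-(lam * κ * n))) := by
          rw [Finset.sum_const, nsmul_eq_mul, ENNReal.ofReal_mul (by positivity),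
            ENNReal.ofReal_natCast]
      _ ≤ _ := by
          refine ENNReal.ofReal_le_ofReal ?_
          have h1 : (s.card : ℝ) ≤ ((N : ℝ) + 1) ^ (k + n) := by
            calc (s.card : ℝ) ≤ (N : ℝ) ^ (k + n) := by exact_mod_cast hs
              _ ≤ _ := by gcongr; linarith
          have h2 : exp (-(lam * κ * n)) = exp (-(lam * κ)) ^ n := by
            rw [← Real.exp_nat_mul]
            congr 1
            ring
          rw [mul_pow, ← mul_assoc, ← pow_add, h2]
          exact mul_le_mul_of_nonneg_right h1 (by positivity)
  have hlim : Filter.Tendsto (fun n : ℕ => ENNReal.ofReal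
      (((N : ℝ) + 1) ^ k * (((N : ℝ) + 1) * exp (-(lam * κ))) ^ n)) Filter.atTop (nhds 0) := by
    have := (tendsto_pow_atTop_nhds_zero_of_lt_one (by positivity) hq).const_mul
      (((N : ℝ) + 1) ^ k)
    rw [mul_zero] at this
    simpa using ENNReal.tendsto_ofReal this
  exact le_antisymm (ge_of_tendsto' hlim hbound) zero_le

/-! ### Volumes in hyperplanes and on the sphere -/

/-- The volume of the unit ball in a hyperplane of `ℝ^d`. -/
def hyperplaneBallVolume (d : ℕ) : ℝ := √π ^ (d - 1) / Gamma ((d - 1 : ℕ) / 2 + 1)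

theorem hyperplaneBallVolume_pos (d : ℕ) : 0 < hyperplaneBallVolume d :=
  div_pos (pow_pos (Real.sqrt_pos.2 Real.pi_pos) _) (Real.Gamma_pos_of_pos (by positivity))

theorem volume_orthogonal_ball {d : ℕ} (hd : 2 ≤ d) (u : USphere d) (z : (ℝ ∙ (u : Euc d))ᗮ)
    {r : ℝ} (hr : 0 ≤ r) :
    volume (Metric.ball z r) = ENNReal.ofReal (r ^ (d - 1) * hyperplaneBallVolume d) := by
  have hu : (u : Euc d) ≠ 0 := by
    intro h
    have : ‖(u : Euc d)‖ = 1 := by simp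
    simp [h] at this
  have : Fact (Module.finrank ℝ (Euc d) = (d - 1) + 1) := ⟨by simp; omega⟩
  have hfin : Module.finrank ℝ (ℝ ∙ (u : Euc d))ᗮ = d - 1 :=
    Submodule.finrank_orthogonal_span_singleton hu
  have : Nontrivial (ℝ ∙ (u : Euc d))ᗮ :=
    Module.nontrivial_of_finrank_pos (R := ℝ) (by rw [hfin]; omega)
  rw [InnerProductSpace.volume_ball, hfin, ENNReal.ofReal_mul (by positivity),
    ENNReal.ofReal_pow hr]
  rfl

/-- Lebesgue measure is the product of Lebesgue measures on a line and on its orthogonal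
complement. -/
theorem lintegral_mul_orthogonal {d : ℕ} (u : USphere d) {f : ℝ → ℝ≥0∞} (hf : Measurable f)
    {g : Euc d → ℝ≥0∞} (hg : Measurable g) :
    ∫⁻ y, f (inner ℝ (u : Euc d) y) * g (y - inner ℝ (u : Euc d) y • (u : Euc d)) =
      (∫⁻ t, f t) * ∫⁻ z : (ℝ ∙ (u : Euc d))ᗮ, g z := by
  have hu : ‖(u : Euc d)‖ = 1 := by simp
  set K : Submodule ℝ (Euc d) := ℝ ∙ (u : Euc d) with hK
  have hmp : MeasurePreserving (fun y : Euc d => (K.orthogonalDecomposition y).ofLp)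
      volume (volume : Measure (K × Kᗮ)) :=
    (WithLp.volume_preserving_ofLp K Kᗮ).comp K.orthogonalDecomposition.measurePreserving
  have hproj : ∀ y : Euc d, (K.orthogonalProjectionOnto y : Euc d)
      = inner ℝ (u : Euc d) y • (u : Euc d) := fun y =>
    Submodule.starProjection_unit_singleton ℝ hu y
  have hproj' : ∀ y : Euc d, (Kᗮ.orthogonalProjectionOnto y : Euc d)
      = y - inner ℝ (u : Euc d) y • (u : Euc d) := by
    intro y
    rw [← hproj]
    exact Submodule.starProjection_orthogonal_val y
  have hfK : Measurable fun a : K => f (inner ℝ (u : Euc d) (a : Euc d)) := hf.comp (by fun_prop)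
  have hgK : Measurable fun b : Kᗮ => g (b : Euc d) := hg.comp (by fun_prop)
  have h1 := hmp.lintegral_comp
    (f := fun q : K × Kᗮ => f (inner ℝ (u : Euc d) (q.1 : Euc d)) * g (q.2 : Euc d))
    ((hfK.comp measurable_fst).mul (hgK.comp measurable_snd))
  have h2 : ∫⁻ a : K, f (inner ℝ (u : Euc d) (a : Euc d)) = ∫⁻ t, f t := by
    have hm := (LinearIsometryEquiv.toSpanUnitSingleton (𝕜 := ℝ) (u : Euc d) hu).measurePreserving
    rw [← hm.lintegral_comp hfK]
    simp [inner_smul_right]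
  have h3 : ∀ y : Euc d, f (inner ℝ (u : Euc d) y) *
        g (y - inner ℝ (u : Euc d) y • (u : Euc d)) =
      f (inner ℝ (u : Euc d) ((K.orthogonalDecomposition y).ofLp.1 : Euc d)) *
        g ((K.orthogonalDecomposition y).ofLp.2 : Euc d) := by
    intro y
    simp only [Submodule.orthogonalDecomposition_apply, hproj, hproj', inner_smul_right,
      real_inner_self_eq_norm_sq, hu]
    simp
  simp_rw [h3]
  have h5 := lintegral_prod_mul (μ := (volume : Measure K)) (ν := (volume : Measure Kᗮ))
    hfK.aemeasurable hgK.aemeasurable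
  rw [h1, Measure.volume_eq_prod, h5, h2]

/-- The volume of the spherical shell with radii `1/2` and `3/4` in a hyperplane of `ℝ^d`. -/
def hyperplaneShellVolume (d : ℕ) : ℝ :=
  ((3 / 4) ^ (d - 1) - (1 / 2) ^ (d - 1)) * hyperplaneBallVolume d

theorem hyperplaneShellVolume_pos {d : ℕ} (hd : 2 ≤ d) : 0 < hyperplaneShellVolume d :=
  mul_pos (sub_pos.2 (pow_lt_pow_left₀ (by norm_num) (by norm_num) (by omega)))
    (hyperplaneBallVolume_pos d)

theorem hyperplaneShellVolume_le {d : ℕ} (hd : 2 ≤ d) (u : USphere d) :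
    ENNReal.ofReal (hyperplaneShellVolume d) ≤
      ∫⁻ z : (ℝ ∙ (u : Euc d))ᗮ, (Metric.ball (0 : Euc d) (3 / 4) \ Metric.ball 0 (1 / 2)).indicator
        1 (z : Euc d) := by
  have h : ∀ z : (ℝ ∙ (u : Euc d))ᗮ,
      (Metric.ball (0 : Euc d) (3 / 4) \ Metric.ball 0 (1 / 2)).indicator
        (1 : Euc d → ℝ≥0∞) (z : Euc d) =
      (Metric.ball (0 : (ℝ ∙ (u : Euc d))ᗮ) (3 / 4) \ Metric.ball 0 (1 / 2)).indicator 1 z := by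
    intro z
    by_cases hz : (z : Euc d) ∈ Metric.ball (0 : Euc d) (3 / 4) \ Metric.ball 0 (1 / 2)
    · rw [Set.indicator_of_mem hz, Set.indicator_of_mem (by simpa using hz)]
      rfl
    · rw [Set.indicator_of_notMem hz, Set.indicator_of_notMem (by simpa using hz)]
  simp_rw [h]
  rw [lintegral_indicator_one (measurableSet_ball.diff measurableSet_ball)]
  refine le_trans ?_ le_measure_sdiff
  rw [volume_orthogonal_ball hd u _ (by norm_num), volume_orthogonal_ball hd u _ (by norm_num),
    ← ENNReal.ofReal_sub _ (mul_nonneg (by positivity) (hyperplaneBallVolume_pos d).le),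
    ← sub_mul]
  rfl

/-- Lower bound for the spherical measure of a band close to an equator. -/
theorem le_sphMeasure_band {d : ℕ} (hd : 2 ≤ d) (v : USphere d) {a : ℝ} (ha : 0 < a)
    (ha4 : a ≤ 1 / 4) :
    ENNReal.ofReal (d * (a * hyperplaneShellVolume d)) ≤
      sphMeasure d {u | inner ℝ (v : Euc d) (u : Euc d) ∈ Set.Ioc a (4 * a)} := by
  have hv : ‖(v : Euc d)‖ = 1 := by simp
  set S : Set (Euc d) := Metric.ball (0 : Euc d) (3 / 4) \ Metric.ball 0 (1 / 2) with hS
  have hSm : MeasurableSet S := measurableSet_ball.diff measurableSet_ball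
  -- The spherical measure of the band is `d` times the volume of the cone over it. This piece of a
  -- slab lies in the cone: `1 / 2 ≤ ‖y‖ < 1` there, because `(3/4)² + (2 a)² < 1`, and hence `⟨v,
  -- y⟩ / ‖y‖` lies between `a` and `4 a`.
  set T : Set (Euc d) := {y | inner ℝ (v : Euc d) y ∈ Set.Ioo a (2 * a) ∧
    y - inner ℝ (v : Euc d) y • (v : Euc d) ∈ S} with hT
  have hvol : ENNReal.ofReal (a * hyperplaneShellVolume d) ≤ volume T := by
    have hTm : MeasurableSet T := by
      refine MeasurableSet.inter (?_ : MeasurableSet ((fun y : Euc d => inner ℝ (v : Euc d) y) ⁻¹'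
        Set.Ioo a (2 * a))) (?_ : MeasurableSet
          ((fun y : Euc d => y - inner ℝ (v : Euc d) y • (v : Euc d)) ⁻¹' S))
      · exact (by fun_prop : Measurable fun y : Euc d => inner ℝ (v : Euc d) y) measurableSet_Ioo
      · exact (by fun_prop : Measurable fun y : Euc d =>
          y - inner ℝ (v : Euc d) y • (v : Euc d)) hSm
    have h1 := lintegral_mul_orthogonal v
      (f := (Set.Ioo a (2 * a)).indicator 1) (measurable_one.indicator measurableSet_Ioo)
      (g := S.indicator 1) (measurable_one.indicator hSm)
    have h2 : ∀ y : Euc d, (Set.Ioo a (2 * a)).indicator (1 : ℝ → ℝ≥0∞) (inner ℝ (v : Euc d) y) *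
        S.indicator (1 : Euc d → ℝ≥0∞) (y - inner ℝ (v : Euc d) y • (v : Euc d)) =
        T.indicator 1 y := by
      intro y
      by_cases h3 : inner ℝ (v : Euc d) y ∈ Set.Ioo a (2 * a)
      · by_cases h4 : y - inner ℝ (v : Euc d) y • (v : Euc d) ∈ S
        · rw [Set.indicator_of_mem h3, Set.indicator_of_mem h4,
            Set.indicator_of_mem (show y ∈ T from ⟨h3, h4⟩)]
          exact one_mul 1
        · rw [Set.indicator_of_notMem h4, mul_zero,
            Set.indicator_of_notMem (fun h : y ∈ T => h4 h.2)]
      · rw [Set.indicator_of_notMem h3, zero_mul,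
          Set.indicator_of_notMem (fun h : y ∈ T => h3 h.1)]
    simp_rw [h2] at h1
    rw [lintegral_indicator_one hTm, lintegral_indicator_one measurableSet_Ioo,
      Real.volume_Ioo] at h1
    rw [h1, ENNReal.ofReal_mul ha.le, show 2 * a - a = a by ring]
    exact mul_le_mul_right (hyperplaneShellVolume_le hd v) _
  have hband : MeasurableSet {u : USphere d | inner ℝ (v : Euc d) (u : Euc d) ∈
      Set.Ioc a (4 * a)} :=
    (by fun_prop : Measurable fun u : USphere d => inner ℝ (v : Euc d) (u : Euc d))
      measurableSet_Ioc
  rw [sphMeasure, Measure.toSphere_apply' _ hband, finrank_euclideanSpace, Fintype.card_fin,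
    ENNReal.ofReal_mul (by positivity), ENNReal.ofReal_natCast]
  refine mul_le_mul_right (hvol.trans (measure_mono ?_)) _
  rintro y ⟨⟨ht1, ht2⟩, hq1, hq2⟩
  set t : ℝ := inner ℝ (v : Euc d) y with ht
  rw [mem_ball_zero_iff] at hq1 hq2
  rw [not_lt] at hq2
  have hq : ‖y - t • (v : Euc d)‖ ^ 2 = ‖y‖ ^ 2 - t ^ 2 := by
    rw [norm_sub_sq_real, inner_smul_right, real_inner_comm, ← ht, norm_smul, hv,
      Real.norm_eq_abs, mul_one, sq_abs]
    ring
  have hy0 : 1 / 2 ≤ ‖y‖ := by nlinarith [norm_nonneg y]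
  have hy1 : ‖y‖ < 1 := by nlinarith [norm_nonneg y, norm_nonneg (y - t • (v : Euc d))]
  have hypos : 0 < ‖y‖ := by linarith
  refine ⟨‖y‖, ⟨hypos, hy1⟩, ‖y‖⁻¹ • y, ⟨⟨‖y‖⁻¹ • y, ?_⟩, ?_, rfl⟩, ?_⟩
  · rw [mem_sphere_zero_iff_norm, norm_smul, norm_inv, norm_norm, inv_mul_cancel₀ hypos.ne']
  · change inner ℝ (v : Euc d) (‖y‖⁻¹ • y) ∈ Set.Ioc a (4 * a)
    rw [inner_smul_right, ← ht, inv_mul_eq_div]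
    constructor
    · rw [lt_div_iff₀ hypos]
      nlinarith
    · rw [div_le_iff₀ hypos]
      nlinarith
  · simp [smul_smul, mul_inv_cancel₀ hypos.ne']

/-! ### Lower bound for the intensity of caps around a point -/

/-- The foot of the line with normal `u` and ideal endpoint `v`. -/
def footOfEndpoint {d : ℕ} (u v : USphere d) : Euc d :=
  (1 + inner ℝ (u : Euc d) (v : Euc d))⁻¹ •
    ((v : Euc d) - inner ℝ (u : Euc d) (v : Euc d) • (u : Euc d))

section

variable {d : ℕ} {u v : USphere d}

theorem inner_footOfEndpoint (u v : USphere d) :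
    inner ℝ (u : Euc d) (footOfEndpoint u v) = 0 := by
  have hu : ‖(u : Euc d)‖ = 1 := by simp
  rw [footOfEndpoint, inner_smul_right, inner_sub_right, inner_smul_right,
    real_inner_self_eq_norm_sq, hu]
  ring

theorem sq_norm_footOfEndpoint (h0 : 0 < inner ℝ (u : Euc d) (v : Euc d)) :
    ‖footOfEndpoint u v‖ ^ 2 = (1 - inner ℝ (u : Euc d) (v : Euc d)) /
      (1 + inner ℝ (u : Euc d) (v : Euc d)) := by
  have hu : ‖(u : Euc d)‖ = 1 := by simp
  have hv : ‖(v : Euc d)‖ = 1 := by simp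
  have hn : ‖(v : Euc d) - inner ℝ (u : Euc d) (v : Euc d) • (u : Euc d)‖ ^ 2 =
      1 - inner ℝ (u : Euc d) (v : Euc d) ^ 2 := by
    rw [norm_sub_sq_real, inner_smul_right, real_inner_comm (v : Euc d), norm_smul, hv, hu,
      Real.norm_eq_abs, mul_one, sq_abs]
    ring
  rw [footOfEndpoint, norm_smul, mul_pow, hn, Real.norm_eq_abs, sq_abs]
  field_simp
  ring

/-- At the exact foot the quantity is `2 h / (1 + h)`, between `h` and `2 h`; a displacement by `h /
5` lowers it by at most `11 h / 25` and raises it by at most `h`. -/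
theorem one_sub_sq_norm_mem (h0 : 0 < inner ℝ (u : Euc d) (v : Euc d)) {x : Euc d}
    (hx : dist x (footOfEndpoint u v) < inner ℝ (u : Euc d) (v : Euc d) / 5) :
    1 - ‖x‖ ^ 2 ∈ Set.Icc (14 / 25 * inner ℝ (u : Euc d) (v : Euc d))
      (3 * inner ℝ (u : Euc d) (v : Euc d)) := by
  have h1 : inner ℝ (u : Euc d) (v : Euc d) ≤ 1 := by
    simpa using real_inner_le_norm (u : Euc d) (v : Euc d)
  have hs2 := sq_norm_footOfEndpoint h0
  have habs := abs_norm_sub_norm_le x (footOfEndpoint u v)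
  rw [← dist_eq_norm] at habs
  set h : ℝ := inner ℝ (u : Euc d) (v : Euc d)
  have hs : 1 - ‖footOfEndpoint u v‖ ^ 2 = 2 * h / (1 + h) := by
    rw [hs2]
    field_simp
    ring
  have hlo : h ≤ 1 - ‖footOfEndpoint u v‖ ^ 2 := by
    rw [hs, le_div_iff₀ (by linarith)]
    nlinarith
  have hhi : 1 - ‖footOfEndpoint u v‖ ^ 2 ≤ 2 * h := by
    rw [hs, div_le_iff₀ (by linarith)]
    nlinarith
  have hr := norm_nonneg x
  set s : ℝ := ‖footOfEndpoint u v‖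
  have hs0 : 0 ≤ s := norm_nonneg _
  have hs1 : s ≤ 1 := by nlinarith
  obtain ⟨ha, hb⟩ := abs_le.1 habs
  have hlow : 14 / 25 * h ≤ 1 - ‖x‖ ^ 2 := by
    have h2 : ‖x‖ ≤ s + h / 5 := by linarith
    have h3 : ‖x‖ ^ 2 ≤ (s + h / 5) ^ 2 := pow_le_pow_left₀ hr h2 2
    nlinarith
  have hr1 : ‖x‖ ≤ 1 := by nlinarith
  refine ⟨hlow, ?_⟩
  have h4 : s - ‖x‖ ≤ h / 5 := by linarith
  nlinarith [mul_le_mul_of_nonneg_right h4 (add_nonneg hs0 hr)]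

theorem capAxisNorm_le_three {t : ℝ} (ht : t ^ 2 ≤ 1) : capAxisNorm t ≤ 3 := by
  have hC : cosh 1 ≤ 2 := by
    have h1 := Real.exp_one_lt_d9
    have h2 : exp (-1) ≤ 1 := Real.exp_le_one_iff.2 (by norm_num)
    rw [Real.cosh_eq]
    linarith
  refine Real.sqrt_le_iff.2 ⟨by norm_num, ?_⟩
  have h1 : cosh 1 ^ 2 ≤ 4 := by nlinarith [Real.cosh_pos 1]
  have h2 : (1 - t ^ 2) ^ 2 ≤ 1 := by nlinarith [sq_nonneg t]
  nlinarith [mul_le_mul h1 h2 (sq_nonneg _) (by norm_num)]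

/-- A line with normal `u` and foot close to that of the line ending in `v` has an endcap
around `v`. -/
theorem endcap_mem_capsAround (h0 : 0 < inner ℝ (u : Euc d) (v : Euc d)) {δ : ℝ}
    (hδ : δ ≤ inner ℝ (u : Euc d) (v : Euc d) ^ 2 / 100) (L : HypLine d) (hL : L.normal = u)
    (hx : dist L.foot (footOfEndpoint u v) < inner ℝ (u : Euc d) (v : Euc d) / 5) :
    L.endcap ∈ capsAround v δ := by
  have h1 : inner ℝ (u : Euc d) (v : Euc d) ≤ 1 := by
    simpa using real_inner_le_norm (u : Euc d) (v : Euc d)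
  have hS := capAxisNorm_pos ‖L.foot‖
  obtain ⟨hlo, hhi⟩ := one_sub_sq_norm_mem h0 hx
  have hS3 : capAxisNorm ‖L.foot‖ ≤ 3 := capAxisNorm_le_three (by linarith)
  have hC : 3 / 2 ≤ cosh 1 := by
    rw [Real.cosh_eq]
    have := Real.exp_one_gt_d9
    have := Real.exp_neg_one_gt_d9
    linarith
  have hs2 := sq_norm_footOfEndpoint h0
  have hxu := L.inner_normal_foot
  rw [hL, real_inner_comm] at hxu
  have hxv : inner ℝ L.foot (v : Euc d) = (1 + inner ℝ (u : Euc d) (v : Euc d)) *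
      inner ℝ L.foot (footOfEndpoint u v) := by
    rw [footOfEndpoint, inner_smul_right, inner_sub_right, inner_smul_right, hxu]
    field_simp
    ring
  have hd2 : dist L.foot (footOfEndpoint u v) ^ 2 = ‖L.foot‖ ^ 2 -
      2 * inner ℝ L.foot (footOfEndpoint u v) + ‖footOfEndpoint u v‖ ^ 2 := by
    rw [dist_eq_norm, norm_sub_sq_real]
  have haxis : inner ℝ L.capAxis (v : Euc d) = 2 * inner ℝ L.foot (v : Euc d) +
      cosh 1 * (1 - ‖L.foot‖ ^ 2) * inner ℝ (u : Euc d) (v : Euc d) := by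
    rw [HypLine.capAxis, inner_add_left, inner_smul_left, inner_smul_left, hL]
    rfl
  change cos (L.endcap.2 : ℝ) + δ < inner ℝ L.centerVec (v : Euc d)
  rw [L.cos_endcap_snd, L.centerVec_eq, inner_smul_left, conj_trivial, inv_mul_eq_div,
    div_add' _ _ _ hS.ne', div_lt_div_iff_of_pos_right hS, haxis, hxv]
  set h : ℝ := inner ℝ (u : Euc d) (v : Euc d)
  set e : ℝ := dist L.foot (footOfEndpoint u v)
  have he0 : 0 ≤ e := dist_nonneg
  have hs3 : (1 + h) * ‖footOfEndpoint u v‖ ^ 2 = 1 - h := by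
    rw [hs2]
    field_simp
  -- Polarization. With `e` the distance to the exact foot, the margin to be shown positive becomes
  -- `(cosh 1 - 1) h (1 - ‖x‖²) - (1 + h) e² - δ S`; the three terms are bounded by `14 h² / 50`, `2
  -- h² / 25` and `3 h² / 100`.
  have hid : 2 * ((1 + h) * inner ℝ L.foot (footOfEndpoint u v)) =
      (1 + h) * ‖L.foot‖ ^ 2 + (1 - h) - (1 + h) * e ^ 2 := by
    rw [hd2, ← hs3]
    ring
  rw [hid]
  have he2 : (1 + h) * e ^ 2 ≤ 2 * (h / 5) ^ 2 :=
    mul_le_mul (by linarith) (pow_le_pow_left₀ he0 hx.le 2) (by positivity) (by norm_num)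
  have hδS : δ * capAxisNorm ‖L.foot‖ ≤ h ^ 2 / 100 * 3 :=
    mul_le_mul hδ hS3 hS.le (by positivity)
  have hmain : 14 / 50 * h ^ 2 ≤ (cosh 1 - 1) * (h * (1 - ‖L.foot‖ ^ 2)) := by
    have h2 : h * (14 / 25 * h) ≤ h * (1 - ‖L.foot‖ ^ 2) := mul_le_mul_of_nonneg_left hlo h0.le
    nlinarith [sq_nonneg h]
  nlinarith [pow_pos h0 2]

/-- The density of lines in a hyperplane, integrated over the lines with an endcap around `v`. -/
theorem le_lintegral_hyperplaneVolume (hd : 2 ≤ d)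
    (h0 : 0 < inner ℝ (u : Euc d) (v : Euc d)) {δ : ℝ}
    (hδ : δ ≤ inner ℝ (u : Euc d) (v : Euc d) ^ 2 / 100) :
    ENNReal.ofReal ((2 / 15) ^ (d - 1) * hyperplaneBallVolume d /
        (3 * inner ℝ (u : Euc d) (v : Euc d))) ≤
      ∫⁻ x, (lineParams (HypLine.endcap ⁻¹' capsAround v δ)).indicator
        (fun p => ENNReal.ofReal (cosh (hypDist p.2 0))) (u, x) ∂hyperplaneVolume u := by
  have hw : Measurable fun x : Euc d => ENNReal.ofReal ((2 / (1 - ‖x‖ ^ 2)) ^ (d - 1)) := by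
    fun_prop
  have hA := measurableSet_lineParams
    (HypLine.measurable_endcap (measurableSet_capsAround v δ))
  have hF : Measurable fun x : Euc d => (lineParams (HypLine.endcap ⁻¹' capsAround v δ)).indicator
      (fun p => ENNReal.ofReal (cosh (hypDist p.2 0))) (u, x) :=
    (measurable_cosh_hypDist.indicator hA).comp measurable_prodMk_left
  rw [hyperplaneVolume, lintegral_withDensity_eq_lintegral_mul _ hw hF,
    ← lintegral_indicator measurableSet_ball,
    lintegral_map ((hw.mul hF).indicator measurableSet_ball) measurable_subtype_coe]
  have hfoot : footOfEndpoint u v ∈ (ℝ ∙ (u : Euc d))ᗮ :=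
    Submodule.mem_orthogonal_singleton_iff_inner_right.2 (inner_footOfEndpoint u v)
  set h : ℝ := inner ℝ (u : Euc d) (v : Euc d) with hh
  set T : Set (ℝ ∙ (u : Euc d))ᗮ := Metric.ball ⟨_, hfoot⟩ (h / 5)
  have hle : ∀ z : (ℝ ∙ (u : Euc d))ᗮ, T.indicator (fun _ =>
      ENNReal.ofReal ((2 / (3 * h)) ^ (d - 1)) * ENNReal.ofReal (1 / (3 * h))) z ≤
      (Metric.ball (0 : Euc d) 1).indicator
        ((fun x : Euc d => ENNReal.ofReal ((2 / (1 - ‖x‖ ^ 2)) ^ (d - 1))) * fun x =>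
        (lineParams (HypLine.endcap ⁻¹' capsAround v δ)).indicator
        (fun p => ENNReal.ofReal (cosh (hypDist p.2 0))) (u, x)) z := by
    intro z
    by_cases hz : z ∈ T
    · have hz' : dist (z : Euc d) (footOfEndpoint u v) < h / 5 := hz
      obtain ⟨hlo, hhi⟩ := one_sub_sq_norm_mem h0 hz'
      rw [← hh] at hlo hhi
      have hpos : 0 < 1 - ‖(z : Euc d)‖ ^ 2 := lt_of_lt_of_le (by positivity) hlo
      have hz1 : ‖(z : Euc d)‖ < 1 := by
        refine lt_of_pow_lt_pow_left₀ 2 zero_le_one ?_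
        linarith
      have huz : inner ℝ (u : Euc d) (z : Euc d) = 0 :=
        Submodule.mem_orthogonal_singleton_iff_inner_right.1 z.2
      have hmem : (u, (z : Euc d)) ∈ lineParams (HypLine.endcap ⁻¹' capsAround v δ) :=
        ⟨⟨(u, z), hz1, huz⟩, endcap_mem_capsAround h0 hδ _ rfl hz', rfl⟩
      have hcosh : 1 / (3 * h) ≤ cosh (hypDist (z : Euc d) 0) := by
        have hnn : 0 ≤ 2 * ‖(z : Euc d)‖ ^ 2 / (1 - ‖(z : Euc d)‖ ^ 2) := by positivity
        have he : 1 + 2 * ‖(z : Euc d)‖ ^ 2 / (1 - ‖(z : Euc d)‖ ^ 2) =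
            (1 + ‖(z : Euc d)‖ ^ 2) / (1 - ‖(z : Euc d)‖ ^ 2) := by
          field_simp
          ring
        have hc : cosh (hypDist (z : Euc d) 0) =
            (1 + ‖(z : Euc d)‖ ^ 2) / (1 - ‖(z : Euc d)‖ ^ 2) := by
          rw [← he, hypDist, sub_zero, norm_zero, zero_pow two_ne_zero, sub_zero, mul_one,
            cosh_arcosh (by linarith)]
        rw [hc]
        exact div_le_div₀ (by positivity) (by linarith [sq_nonneg ‖(z : Euc d)‖]) hpos hhi
      rw [Set.indicator_of_mem hz, Set.indicator_of_mem (mem_ball_zero_iff.2 hz1), Pi.mul_apply,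
        Set.indicator_of_mem hmem]
      refine mul_le_mul' (ENNReal.ofReal_le_ofReal ?_) (ENNReal.ofReal_le_ofReal hcosh)
      exact pow_le_pow_left₀ (by positivity) (div_le_div_of_nonneg_left (by norm_num) hpos hhi) _
    · rw [Set.indicator_of_notMem hz]
      exact zero_le
  refine le_trans (le_of_eq ?_) (lintegral_mono hle)
  rw [lintegral_indicator_const measurableSet_ball,
    volume_orthogonal_ball hd u _ (by positivity),
    ← ENNReal.ofReal_mul (by positivity), ← ENNReal.ofReal_mul (by positivity)]
  congr 1
  -- The Euclidean volume `(h / 5)^(d - 1)` of the ball of feet cancels the hyperbolic density,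
  -- leaving only the factor `1 / (3 h)` from the `cosh` weight.
  have e : (2 / 15 : ℝ) ^ (d - 1) = (2 / (3 * h)) ^ (d - 1) * (h / 5) ^ (d - 1) := by
    rw [← mul_pow]
    congr 1
    field_simp
    norm_num
  rw [e]
  ring

end

/-! ### Summation over scales -/

theorem sphereArea_pos {d : ℕ} (hd : 2 ≤ d) : 0 < sphereArea d := by
  have : (0 : ℝ) < d := by positivity
  exact div_pos (by positivity) (Real.Gamma_pos_of_pos (by positivity))

/-- The mean number of endcaps around a point, on one scale, is at least this constant. -/
def capRate (d : ℕ) : ℝ :=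
  (sphereArea d)⁻¹ *
    ((2 / 15) ^ (d - 1) * hyperplaneBallVolume d / 12 * (d * hyperplaneShellVolume d))

theorem capRate_pos {d : ℕ} (hd : 2 ≤ d) : 0 < capRate d := by
  have := sphereArea_pos hd
  have := hyperplaneBallVolume_pos d
  have := hyperplaneShellVolume_pos hd
  have : (0 : ℝ) < d := by positivity
  unfold capRate
  positivity

theorem le_endcapMeasure_capsAround {d : ℕ} (hd : 2 ≤ d) (n : ℕ) (v : USphere d) :
    ENNReal.ofReal (capRate d * n) ≤ endcapMeasure d (capsAround v (1 / 100 * (1 / 16) ^ n)) := by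
  have hball := hyperplaneBallVolume_pos d
  have hshell := hyperplaneShellVolume_pos hd
  have harea := sphereArea_pos hd
  have hB := measurableSet_capsAround v (1 / 100 * (1 / 16) ^ n)
  rw [endcapMeasure, Measure.map_apply HypLine.measurable_endcap hB, lineMeasure,
    Measure.ofMeasurable_apply _ (HypLine.measurable_endcap hB), capRate, mul_assoc,
    ENNReal.ofReal_mul (by positivity), ENNReal.ofReal_inv_of_pos harea]
  refine mul_le_mul_right ?_ _
  set I : USphere d → ℝ≥0∞ := fun u => ∫⁻ x,
    (lineParams (HypLine.endcap ⁻¹' capsAround v (1 / 100 * (1 / 16) ^ n))).indicator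
      (fun p => ENNReal.ofReal (cosh (hypDist p.2 0))) (u, x) ∂hyperplaneVolume u
  set c : ℝ := (2 / 15) ^ (d - 1) * hyperplaneBallVolume d
  have hc : 0 < c := by positivity
  -- On the bands with `k < n` one has `⟨u, v⟩ > 4^(-n)`, so the margin `⟨u, v⟩² / 100` exceeds
  -- `16^(-n) / 100`.
  set band : ℕ → Set (USphere d) := fun k =>
    {u | inner ℝ (v : Euc d) (u : Euc d) ∈ Set.Ioc ((1 / 4 : ℝ) ^ (k + 1)) ((1 / 4) ^ k)}
  have hband : ∀ k, MeasurableSet (band k) := fun k =>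
    (by fun_prop : Measurable fun u : USphere d => inner ℝ (v : Euc d) (u : Euc d))
      measurableSet_Ioc
  have hdisj : Pairwise (fun i j => Disjoint (band i) (band j)) := by
    intro i j hij
    have hanti : Antitone fun k : ℕ => (1 / 4 : ℝ) ^ k := fun _ _ hk =>
      pow_le_pow_of_le_one (by norm_num) (by norm_num) hk
    exact (hanti.pairwise_disjoint_on_Ioc_succ hij).preimage
      fun u : USphere d => inner ℝ (v : Euc d) (u : Euc d)
  have hone : ∀ k < n, ENNReal.ofReal (c / 12 * (d * hyperplaneShellVolume d)) ≤
      ∫⁻ u in band k, I u ∂sphMeasure d := by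
    intro k hk
    have ha : (0 : ℝ) < (1 / 4) ^ (k + 1) := by positivity
    have ha1 : (1 / 4 : ℝ) ^ (k + 1) ≤ 1 / 4 := pow_le_of_le_one (by norm_num) (by norm_num)
      (Nat.succ_ne_zero k)
    have hk4 : (1 / 4 : ℝ) ^ k = 4 * (1 / 4) ^ (k + 1) := by
      rw [pow_succ]
      ring
    have hkn : (1 / 4 : ℝ) ^ n ≤ (1 / 4) ^ (k + 1) :=
      pow_le_pow_of_le_one (by norm_num) (by norm_num) hk
    have h16 : (1 / 16 : ℝ) ^ n = ((1 / 4) ^ n) ^ 2 := by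
      rw [← pow_mul, mul_comm, pow_mul]
      norm_num
    -- The powers of `1 / 4` from weight and band measure cancel up to one factor `4`, whence `12 =
    -- 3 * 4`, whatever the scale.
    calc ENNReal.ofReal (c / 12 * (d * hyperplaneShellVolume d))
        = ENNReal.ofReal (c / (3 * (1 / 4) ^ k)) *
            ENNReal.ofReal (d * ((1 / 4) ^ (k + 1) * hyperplaneShellVolume d)) := by
          rw [← ENNReal.ofReal_mul (by positivity), hk4]
          congr 1
          field_simp
          norm_num
      _ ≤ ENNReal.ofReal (c / (3 * (1 / 4) ^ k)) * sphMeasure d (band k) := by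
          refine mul_le_mul_right ?_ _
          have := le_sphMeasure_band hd v ha ha1
          rwa [← hk4] at this
      _ = ∫⁻ _ in band k, ENNReal.ofReal (c / (3 * (1 / 4) ^ k)) ∂sphMeasure d := by
          rw [setLIntegral_const]
      _ ≤ _ := by
          refine setLIntegral_mono' (hband k) fun u hu => ?_
          obtain ⟨hu1, hu2⟩ : inner ℝ (v : Euc d) (u : Euc d) ∈
            Set.Ioc ((1 / 4 : ℝ) ^ (k + 1)) ((1 / 4) ^ k) := hu
          rw [real_inner_comm] at hu1 hu2
          have hu0 := ha.trans hu1
          refine le_trans (ENNReal.ofReal_le_ofReal ?_)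
            (le_lintegral_hyperplaneVolume hd hu0 ?_)
          · exact div_le_div_of_nonneg_left hc.le (by positivity) (by linarith)
          · have := pow_le_pow_left₀ (by positivity) (hkn.trans hu1.le) 2
            rw [h16]
            linarith
  calc ENNReal.ofReal (c / 12 * (d * hyperplaneShellVolume d) * n)
      = ∑ _k ∈ Finset.range n, ENNReal.ofReal (c / 12 * (d * hyperplaneShellVolume d)) := by
        rw [Finset.sum_const, Finset.card_range, nsmul_eq_mul, mul_comm,
          ENNReal.ofReal_mul (by positivity), ENNReal.ofReal_natCast]
    _ ≤ ∑ k ∈ Finset.range n, ∫⁻ u in band k, I u ∂sphMeasure d :=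
        Finset.sum_le_sum fun k hk => hone k (Finset.mem_range.1 hk)
    _ = ∫⁻ u in ⋃ k ∈ Finset.range n, band k, I u ∂sphMeasure d :=
        (lintegral_biUnion_finset (fun i _ j _ hij => hdisj hij) (fun k _ => hband k) I).symm
    _ ≤ ∫⁻ u, I u ∂sphMeasure d := setLIntegral_le_lintegral _ _

end

theorem theorem3p3 (d : ℕ) (hd : 2 ≤ d) :
    (∀ L : HypLine d, L.endcapSet = sphCap L.endcap.1 L.endcap.2) ∧
    (∀ (lam : ℝ≥0) (Ω : Type*) [MeasurableSpace Ω] (P : Measure Ω) [IsProbabilityMeasure P]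
      (η : Ω → Measure (HypLine d)), IsPoissonProcess η (lam • lineMeasure d) P →
        IsPoissonProcess (fun ω => (η ω).map HypLine.endcap) (lam • endcapMeasure d) P) ∧
    ∃ lam₁ : ℝ≥0, ∀ lam : ℝ≥0, lam₁ < lam →
      ∀ (Ω : Type*) [MeasurableSpace Ω] (P : Measure Ω) [IsProbabilityMeasure P]
        (Φ : Ω → Measure (USphere d × Set.Ioc (0 : ℝ) π)),
        IsPoissonProcess Φ (lam • endcapMeasure d) P →
          ∀ᵐ ω ∂P, coveredRegion (Φ ω) = Set.univ := by
  refine ⟨HypLine.endcapSet_eq_sphCap, fun lam Ω _ P _ η hη => ?_, ?_⟩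
  · have := hη.map HypLine.measurable_endcap
    rwa [Measure.map_smul] at this
  -- Here `ε = 1 / 16`, `A = 1 / 100`, and `k = 2` suffices because `2 / 256 ≤ 1 / 100`.
  · obtain ⟨lam₁, h⟩ := exists_intensity_covering (capRate_pos hd) (by norm_num) 2 (by norm_num)
      (le_endcapMeasure_capsAround hd)
    exact ⟨lam₁, fun lam hlam Ω _ P _ Φ hΦ => h lam hlam Ω P Φ hΦ⟩
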